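/- Let $s\ge 1$ be an integer and let $R$ be a commutative ring with unit (for instance a commutative algebra over some base ring $k$). Words are finite sequences $w=(i_1\dots i_n)$ of letters $i_j\in\{1,\dots,s\}$, and $|w|=n$ is the length of $w$. Let $$\mathfrak M^s(R)=\Big\{\sum_{|w|\ge 1}\alpha_w z_w \;:\; \alpha_w\in R\Big\},\qquad z_w=z_{i_1}\cdots z_{i_n},$$ be the set of formal power series without constant term in $s$ non-commuting indeterminates $z_1,\dots,z_s$ (for $s=1$: power series in one variable), with component-wise addition. Write $f_w$ for the coefficient of $z_w$ in $f$. Let $\mathrm{NC}(n)$ be the set of non-crossing partitions of $\{1<\dots<n\}$, ordered by $\sigma\le\pi$ if every block of $\sigma$ is contained in a block of $\pi$. The Kreweras complement $K(\pi)\in\mathrm{NC}(n)$ of $\pi\in\mathrm{NC}(n)$ is the largest non-crossing partition of $\{\bar 1<\dots<\bar n\}\cong\{1<\dots<n\}$ such that $\pi\cup K(\pi)$ is a non-crossing partition of $\{1<\bar 1<2<\bar 2<\dots<n<\bar n\}$. For a word $w=(i_1\dots i_n)$ and $V=\{v_1<\dots<v_m\}\subseteq\{1,\dots,n\}$ put $w|V=(i_{v_1}\dots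 i_{v_m})$, and for $\pi\in\mathrm{NC}(n)$ put $f_{w,\pi}=\prod_{V\in\pi}f_{w|V}$. The boxed convolution $\boxtimes$ on $\mathfrak M^s(R)$ is defined by $$(f\boxtimes g)_w=\sum_{\pi\in\mathrm{NC}(|w|)}f_{w,\pi}\,g_{w,K(\pi)}\qquad(|w|\ge 1).$$ Let $\mathfrak G^s(R)\subseteq\mathfrak M^s(R)$ be the set of those series $f$ all of whose linear coefficients $f_{(1)},\dots,f_{(s)}$ are units of $R$. Then: 1. $(\mathfrak M^s(R),+)$ is an abelian group, with neutral element the series all of whose coefficients are zero. 2. $(\mathfrak M^s(R),\boxtimes)$ is a monoid: $\boxtimes$ is associative, with two-sided unit $z_1+\dots+z_s$. 3. If $R\ne 0$, then $\boxtimes$ distributes over $+$ on neither side: there are $f,\tilde f,g\in\mathfrak M^s(R)$ with $(f+\tilde f)\boxtimes g\ne f\boxtimes g+\tilde f\boxtimes g$, and there are $f,g,\tilde g\in\mathfrak M^s(R)$ with $f\boxtimes(g+\tilde g)\ne f\boxtimes g+f\boxtimes\tilde g$. For $s=1$ the operation $\boxtimes$ is commutative on $\mathfrak M^s(R)$; for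 $s\ge 2$ and $R\neq 0$ it is not. 4. $(\mathfrak G^s(R),\boxtimes)$ is a group with neutral element $z_1+\dots+z_s$. For $s=1$ it is abelian; for $s\ge2$ and $R\ne0$ it is non-abelian. -/

import Mathlib

/-! ### Non-crossing partitions and the Kreweras complement -/

/-- A family of blocks in a linearly ordered set is non-crossing if there are no
`p₁ < q₁ < p₂ < q₂` with `p₁, p₂` in one block and `q₁, q₂` in a different block. -/
def IsNonCrossing {α : Type*} [LinearOrder α] (P : Finset (Finset α)) : Prop :=
  ∀ V ∈ P, ∀ W ∈ P, ∀ p₁ q₁ p₂ q₂ : α, p₁ < q₁ → q₁ < p₂ → p₂ < q₂ →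
    p₁ ∈ V → p₂ ∈ V → q₁ ∈ W → q₂ ∈ W → V = W

/-- `NC n`: the non-crossing partitions of an ordered set with `n` elements, ordered by
`σ ≤ π` iff every block of `σ` is contained in a block of `π`. -/
abbrev NC (n : ℕ) : Type :=
  {π : Finpartition (Finset.univ : Finset (Fin n)) // IsNonCrossing π.parts}

noncomputable instance (n : ℕ) : Fintype (NC n) := Fintype.ofFinite _

/-- The blocks of `π ∪ σ` in the ordered set `1 < 1' < 2 < 2' < ⋯ < n < n'`, where `π` lives on
the elements `i` and `σ` on the elements `i'`.  The element `i` is `(i, false)`, the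
element `i'` is `(i, true)`, and the order is lexicographic. -/
def interleave {n : ℕ} (π σ : Finpartition (Finset.univ : Finset (Fin n))) :
    Finset (Finset (Fin n ×ₗ Bool)) :=
  π.parts.image (fun V => V.image fun i => toLex (i, false)) ∪
    σ.parts.image (fun V => V.image fun i => toLex (i, true))

/-- The equivalence relation on `Fin n` whose classes turn out to be the blocks of the Kreweras
complement (auxiliary, for the existence of the complement). -/
def krewerasSetoid {n : ℕ} (π : NC n) : Setoid (Fin n) where
  r i j := ∀ V ∈ π.1.parts, ∀ a ∈ V, ∀ b ∈ V, ((a ≤ i ↔ a ≤ j) ↔ (b ≤ i ↔ b ≤ j))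
  iseqv :=
    { refl := fun i V _ a _ b _ => by simp
      symm := fun {i j} h V hV a ha b hb => by have := h V hV a ha b hb; tauto
      trans := fun {i j k} h h' V hV a ha b hb => by
        have h1 := h V hV a ha b hb
        have h2 := h' V hV a ha b hb
        tauto }

theorem exists_isGreatest_kreweras {n : ℕ} (π : NC n) :
    ∃ σ : NC n, IsGreatest {σ : NC n | IsNonCrossing (interleave π.1 σ.1)} σ := by
  classical
  set K : Finpartition (Finset.univ : Finset (Fin n)) :=
    Finpartition.ofSetoid (krewerasSetoid π) with hK
  have hrel : ∀ V ∈ K.parts, ∀ i ∈ V, ∀ j ∈ V, (krewerasSetoid π).r i j := by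
    intro V hV i hi j hj
    have : j ∈ K.part i := by rw [K.part_eq_of_mem hV hi]; exact hj
    exact Finpartition.mem_part_ofSetoid_iff_rel.1 this
  have hrel' : ∀ V ∈ K.parts, ∀ W ∈ K.parts, ∀ i ∈ V, ∀ j ∈ W,
      (krewerasSetoid π).r i j → V = W := by
    intro V hV W hW i hi j hj h
    have : j ∈ K.part i := Finpartition.mem_part_ofSetoid_iff_rel.2 h
    rw [K.part_eq_of_mem hV hi] at this
    exact K.eq_of_mem_parts hV hW this hj
  have hKnc : IsNonCrossing K.parts := by
    intro V hV W hW p₁ q₁ p₂ q₂ h1 h2 h3 hp1 hp2 hq1 hq2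
    refine hrel' V hV W hW p₁ hp1 q₁ hq1 fun U hU a ha b hb => ?_
    have e1 := hrel V hV p₁ hp1 p₂ hp2 U hU a ha b hb
    have e2 := hrel W hW q₁ hq1 q₂ hq2 U hU a ha b hb
    grind
  have hb₁ : (false < true) = True := by decide
  have hb₂ : (true < false) = False := by decide
  refine ⟨⟨K, hKnc⟩, ?_, ?_⟩
  · intro V hV W hW p₁ q₁ p₂ q₂ h1 h2 h3 hp1 hp2 hq1 hq2
    simp only [interleave, Finset.mem_union, Finset.mem_image] at hV hW
    rcases hV with ⟨V, hV, rfl⟩ | ⟨V, hV, rfl⟩ <;> rcases hW with ⟨W, hW, rfl⟩ | ⟨W, hW, rfl⟩ <;>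
      simp only [Finset.mem_image] at hp1 hp2 hq1 hq2 <;>
      obtain ⟨p₁, hp1, rfl⟩ := hp1 <;> obtain ⟨p₂, hp2, rfl⟩ := hp2 <;>
      obtain ⟨q₁, hq1, rfl⟩ := hq1 <;> obtain ⟨q₂, hq2, rfl⟩ := hq2 <;>
      simp [Prod.Lex.toLex_lt_toLex, hb₁, hb₂, ← le_iff_lt_or_eq] at h1 h2 h3
    · rw [π.2 V hV W hW p₁ q₁ p₂ q₂ h1 h2 h3 hp1 hp2 hq1 hq2]
    · have := hrel W hW q₁ hq1 q₂ hq2 V hV p₁ hp1 p₂ hp2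
      exfalso
      clear hrel hrel' hKnc hK
      grind
    · have := hrel V hV p₁ hp1 p₂ hp2 W hW q₁ hq1 q₂ hq2
      exfalso
      clear hrel hrel' hKnc hK
      grind
    · rw [hKnc V hV W hW p₁ q₁ p₂ q₂ h1 h2 h3 hp1 hp2 hq1 hq2]
  · intro σ hσ
    have key : ∀ W ∈ σ.1.parts, ∀ i ∈ W, ∀ j ∈ W, i < j → (krewerasSetoid π).r i j := by
      intro W hW i hi j hj hij V hV
      have hVm : (V.image fun i => toLex (i, false)) ∈ interleave π.1 σ.1 :=
        Finset.mem_union_left _ (Finset.mem_image_of_mem _ hV)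
      have hWm : (W.image fun i => toLex (i, true)) ∈ interleave π.1 σ.1 :=
        Finset.mem_union_right _ (Finset.mem_image_of_mem _ hW)
      have hne : (V.image fun i => (toLex (i, false) : Fin n ×ₗ Bool)) ≠
          W.image fun i => toLex (i, true) := by
        intro h
        have : (toLex (i, true) : Fin n ×ₗ Bool) ∈ V.image fun i => toLex (i, false) := by
          rw [h]; exact Finset.mem_image_of_mem _ hi
        simp at this
      have main : ∀ a ∈ V, ∀ b ∈ V, i < a → a ≤ j → ¬ (b ≤ i) ∧ b ≤ j := by
        intro a ha b hb hia haj
        have ma : (toLex (a, false) : Fin n ×ₗ Bool) ∈ V.image fun i => toLex (i, false) :=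
          Finset.mem_image_of_mem _ ha
        have mb : (toLex (b, false) : Fin n ×ₗ Bool) ∈ V.image fun i => toLex (i, false) :=
          Finset.mem_image_of_mem _ hb
        have mi : (toLex (i, true) : Fin n ×ₗ Bool) ∈ W.image fun i => toLex (i, true) :=
          Finset.mem_image_of_mem _ hi
        have mj : (toLex (j, true) : Fin n ×ₗ Bool) ∈ W.image fun i => toLex (i, true) :=
          Finset.mem_image_of_mem _ hj
        constructor
        · intro hbi
          refine hne (hσ _ hVm _ hWm _ _ _ _ ?_ ?_ ?_ mb ma mi mj) <;>
            simp [Prod.Lex.toLex_lt_toLex, ← le_iff_lt_or_eq, *]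
        · by_contra hbj
          rw [not_le] at hbj
          refine hne (hσ _ hWm _ hVm _ _ _ _ ?_ ?_ ?_ mi mj ma mb).symm <;>
            simp [Prod.Lex.toLex_lt_toLex, ← le_iff_lt_or_eq, *]
      intro a ha b hb
      have h1 := main a ha b hb
      have h2 := main b hb a ha
      grind
    intro W hW
    obtain ⟨i, hi⟩ := σ.1.nonempty_of_mem_parts hW
    refine ⟨K.part i, K.part_mem.2 (Finset.mem_univ _), fun j hj => ?_⟩
    refine Finpartition.mem_part_ofSetoid_iff_rel.2 ?_
    rcases lt_trichotomy i j with h | h | h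
    · exact key W hW i hi j hj h
    · subst h; exact (krewerasSetoid π).refl _
    · exact (krewerasSetoid π).symm (key W hW j hj i hi h)

/-- The Kreweras complement of `π`: the largest non-crossing partition `σ` of `1' < ⋯ < n'`
such that `π ∪ σ` is a non-crossing partition of `1 < 1' < ⋯ < n < n'`, read as a partition
of `1 < ⋯ < n`. -/
noncomputable def kreweras {n : ℕ} (π : NC n) : NC n :=
  (exists_isGreatest_kreweras π).choose

theorem kreweras_isGreatest {n : ℕ} (π : NC n) :
    IsGreatest {σ : NC n | IsNonCrossing (interleave π.1 σ.1)} (kreweras π) :=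
  (exists_isGreatest_kreweras π).choose_spec

/-! ### Power series without constant term and the boxed convolution -/

/-- Words over the alphabet `{1, …, s}`. -/
abbrev Word (s : ℕ) : Type := List (Fin s)

/-- The restriction `w|V` of the word `w` to the set `V` of positions. -/
def Word.restrict {s : ℕ} (w : Word s) (V : Finset (Fin w.length)) : Word s :=
  (V.sort (· ≤ ·)).map w.get

/-- `MSeries s R`: formal power series without constant term in `s` non-commuting
indeterminates with coefficients in `R`; `f.coeff w` is the coefficient of the monomial `z_w`. -/
@[ext]
structure MSeries (s : ℕ) (R : Type*) [CommRing R] where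
  coeff : Word s → R
  coeff_nil : coeff [] = 0

namespace MSeries

variable {s : ℕ} {R : Type*} [CommRing R]

/-- The series with all coefficients equal to zero. -/
instance : Zero (MSeries s R) := ⟨⟨fun _ => 0, rfl⟩⟩

/-- Component-wise addition. -/
instance : Add (MSeries s R) :=
  ⟨fun f g => ⟨fun w => f.coeff w + g.coeff w, by simp [coeff_nil]⟩⟩

/-- The indeterminate `z_i`. -/
def z (i : Fin s) : MSeries s R := ⟨fun w => if w = [i] then 1 else 0, by simp⟩

/-- The polynomial `z_1 + ⋯ + z_s`. -/
def boxOne (s : ℕ) (R : Type*) [CommRing R] : MSeries s R :=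
  ⟨fun w => ∑ i : Fin s, (z i : MSeries s R).coeff w, by simp [coeff_nil]⟩

/-- `f.partCoeff w π` is the product of the coefficients of `f` at the words `w|V`, over all
blocks `V` of `π`. -/
def partCoeff (f : MSeries s R) (w : Word s)
    (π : Finpartition (Finset.univ : Finset (Fin w.length))) : R :=
  ∏ V ∈ π.parts, f.coeff (w.restrict V)

/-- The boxed convolution. -/
noncomputable def box (f g : MSeries s R) : MSeries s R where
  coeff w := if w = [] then 0 else
    ∑ π : NC w.length, f.partCoeff w π.1 * g.partCoeff w (kreweras π).1
  coeff_nil := by simp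

/-- The series whose linear coefficients are units of `R`. -/
def unitSeries (s : ℕ) (R : Type*) [CommRing R] : Set (MSeries s R) :=
  {f | ∀ i : Fin s, IsUnit (f.coeff [i])}

end MSeries

infixl:70 " ⊠ " => MSeries.box

/-! The coefficient of a boxed convolution at `w` depends only on the coefficients at subwords, that
is, on functions of finite sets of positions. So everything is proved for `conv φ ψ V`, where `φ`
and `ψ` are functions on finite subsets of a linear order. Non-crossing partitions are plain
families of blocks there, so that a block can itself be partitioned.

Associativity: expanding both sides (`prod_conv`) gives sums over pairs, `Q` refining `P` on the
left and `Q`, `R` with `R` refining `kr V Q` on the right. The map `P ↦ relKr P Q` is a bijection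
from the partitions above `Q` to those below `kr V Q`, and `relKr (kr V Q) (relKr P Q) = kr V P`
(`relKr_kr_relKr`) matches the summands.

Unit: the function supported on one-element sets selects the partition into singletons, whose
complement is `{V}`. Reversing the order turns `kr` into its inverse and hence swaps the factors
(`conv_map_of_strictAnti`); this gives the right unit from the left one, and commutativity when
there is only one letter.

Inverses: the term of the one-block partition is the top coefficient times a product of linear ones,
so a left inverse can be solved for by recursion on length. The negative statements are read off
from the coefficients of degree two and three. -/

/-! ### Non-crossing partitions as families of blocks. -/

section NCPartitions

variable {α : Type*}

/-- Two elements lie in a common block of `P`. -/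
def SameBlock (P : Finset (Finset α)) (x y : α) : Prop := ∃ U ∈ P, x ∈ U ∧ y ∈ U

theorem SameBlock.symm {P : Finset (Finset α)} {x y : α} (h : SameBlock P x y) :
    SameBlock P y x := by
  obtain ⟨U, hU, hx, hy⟩ := h
  exact ⟨U, hU, hy, hx⟩

variable [LinearOrder α]

/-- `P` is a non-crossing partition of the finite set `V`. -/
def IsNCPartition (V : Finset α) (P : Finset (Finset α)) : Prop :=
  (∀ U ∈ P, U.Nonempty ∧ U ⊆ V) ∧ (∀ x ∈ V, ∃ U ∈ P, x ∈ U) ∧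
    (∀ U ∈ P, ∀ W ∈ P, ∀ x ∈ U, x ∈ W → U = W) ∧
    (∀ U ∈ P, ∀ W ∈ P, ∀ p₁ ∈ U, ∀ q₁ ∈ W, ∀ p₂ ∈ U, ∀ q₂ ∈ W,
      p₁ < q₁ → q₁ < p₂ → p₂ < q₂ → U = W)

instance (V : Finset α) (P : Finset (Finset α)) : Decidable (IsNCPartition V P) := by
  unfold IsNCPartition; infer_instance

namespace IsNCPartition

variable {V : Finset α} {P Q : Finset (Finset α)}

theorem eq_of_mem (h : IsNCPartition V P) {U W : Finset α} (hU : U ∈ P) (hW : W ∈ P) {x : α}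
    (hx : x ∈ U) (hx' : x ∈ W) : U = W :=
  h.2.2.1 U hU W hW x hx hx'

theorem mem_left (h : IsNCPartition V P) {x y : α} (hxy : SameBlock P x y) : x ∈ V := by
  obtain ⟨U, hU, hx, -⟩ := hxy
  exact (h.1 U hU).2 hx

theorem mem_right (h : IsNCPartition V P) {x y : α} (hxy : SameBlock P x y) : y ∈ V :=
  h.mem_left hxy.symm

theorem refl (h : IsNCPartition V P) {x : α} (hx : x ∈ V) : SameBlock P x x := by
  obtain ⟨U, hU, hx⟩ := h.2.1 x hx
  exact ⟨U, hU, hx, hx⟩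

theorem trans (h : IsNCPartition V P) {x y z : α} (hxy : SameBlock P x y)
    (hyz : SameBlock P y z) : SameBlock P x z := by
  obtain ⟨U, hU, hx, hy⟩ := hxy
  obtain ⟨W, hW, hy', hz⟩ := hyz
  obtain rfl := h.eq_of_mem hU hW hy hy'
  exact ⟨U, hU, hx, hz⟩

theorem nc (h : IsNCPartition V P) {p₁ q₁ p₂ q₂ : α} (h₁ : p₁ < q₁) (h₂ : q₁ < p₂)
    (h₃ : p₂ < q₂) (hp : SameBlock P p₁ p₂) (hq : SameBlock P q₁ q₂) : SameBlock P p₁ q₁ := by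
  obtain ⟨U, hU, hp₁, hp₂⟩ := hp
  obtain ⟨W, hW, hq₁, hq₂⟩ := hq
  obtain rfl := h.2.2.2 U hU W hW _ hp₁ _ hq₁ _ hp₂ _ hq₂ h₁ h₂ h₃
  exact ⟨U, hU, hp₁, hq₁⟩

theorem mem_iff_sameBlock (h : IsNCPartition V P) {U : Finset α} (hU : U ∈ P) {x : α}
    (hx : x ∈ U) (y : α) : y ∈ U ↔ SameBlock P x y := by
  refine ⟨fun hy => ⟨U, hU, hx, hy⟩, fun ⟨W, hW, hx', hy⟩ => ?_⟩
  obtain rfl := h.eq_of_mem hU hW hx hx'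
  exact hy

theorem subset_of_sameBlock (h : IsNCPartition V P) (h' : IsNCPartition V Q)
    (hPQ : ∀ x y, SameBlock P x y ↔ SameBlock Q x y) : P ⊆ Q := by
  intro U hU
  obtain ⟨x, hx⟩ := (h.1 U hU).1
  obtain ⟨W, hW, hxW⟩ := h'.2.1 x ((h.1 U hU).2 hx)
  have : U = W := by
    ext y
    rw [h.mem_iff_sameBlock hU hx, h'.mem_iff_sameBlock hW hxW, hPQ]
  rwa [this]

/-- This reduces the identities between complements below to equivalences of `SameBlock` relations.
-/
theorem ext (h : IsNCPartition V P) (h' : IsNCPartition V Q)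
    (hPQ : ∀ x y, SameBlock P x y ↔ SameBlock Q x y) : P = Q :=
  (h.subset_of_sameBlock h' hPQ).antisymm (h'.subset_of_sameBlock h fun x y => (hPQ x y).symm)

end IsNCPartition

/-- The blocks of the classes of `r` in `V`. -/
def classesOn (V : Finset α) (r : α → α → Prop) [DecidableRel r] : Finset (Finset α) :=
  V.image fun i => V.filter (r i)

theorem sameBlock_classesOn {V : Finset α} {r : α → α → Prop} [DecidableRel r]
    (hr : Equivalence r) {i j : α} :
    SameBlock (classesOn V r) i j ↔ i ∈ V ∧ j ∈ V ∧ r i j := by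
  simp only [SameBlock, classesOn, Finset.mem_image, exists_exists_and_eq_and,
    Finset.mem_filter]
  constructor
  · rintro ⟨k, -, ⟨hi, hki⟩, hj, hkj⟩
    exact ⟨hi, hj, hr.trans (hr.symm hki) hkj⟩
  · rintro ⟨hi, hj, hij⟩
    exact ⟨i, hi, ⟨hi, hr.refl i⟩, hj, hij⟩

theorem isNCPartition_classesOn {V : Finset α} {r : α → α → Prop} [DecidableRel r]
    (hr : Equivalence r)
    (hnc : ∀ p₁ q₁ p₂ q₂, p₁ < q₁ → q₁ < p₂ → p₂ < q₂ → r p₁ p₂ → r q₁ q₂ → r p₁ q₁) :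
    IsNCPartition V (classesOn V r) := by
  have heq : ∀ i j, r i j → V.filter (r i) = V.filter (r j) := by
    intro i j hij
    ext k
    simp only [Finset.mem_filter, and_congr_right_iff]
    exact fun _ => ⟨fun h => hr.trans (hr.symm hij) h, fun h => hr.trans hij h⟩
  simp only [IsNCPartition, classesOn, Finset.mem_image, forall_exists_index, and_imp,
    forall_apply_eq_imp_iff₂, Finset.mem_filter]
  refine ⟨fun i hi => ⟨⟨i, by simp [hi, hr.refl]⟩, Finset.filter_subset _ _⟩,
    fun i hi => ⟨_, ⟨i, hi, rfl⟩, by simp [hi, hr.refl]⟩, ?_, ?_⟩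
  · intro i _ j _ x _ hix _ hjx
    exact heq _ _ (hr.trans hix (hr.symm hjx))
  · intro i _ j _ p₁ _ hp₁ q₁ _ hq₁ p₂ _ hp₂ q₂ _ hq₂ h₁ h₂ h₃
    refine heq _ _ (hr.trans hp₁ (hr.trans ?_ (hr.symm hq₁)))
    exact hnc p₁ q₁ p₂ q₂ h₁ h₂ h₃ (hr.trans (hr.symm hp₁) hp₂) (hr.trans (hr.symm hq₁) hq₂)

/-! ### The Kreweras complement and its inverse, through cut relations. -/

/-- For `i ≤ j`: no block of `P` meets both the half-open interval `(i, j]` and its complement. -/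
def CutRight (P : Finset (Finset α)) (i j : α) : Prop :=
  ∀ U ∈ P, ∀ a ∈ U, ∀ b ∈ U, ((a ≤ i ↔ a ≤ j) ↔ (b ≤ i ↔ b ≤ j))

/-- For `i ≤ j`: no block of `P` meets both the half-open interval `[i, j)` and its complement. -/
def CutLeft (P : Finset (Finset α)) (i j : α) : Prop :=
  ∀ U ∈ P, ∀ a ∈ U, ∀ b ∈ U, ((i ≤ a ↔ j ≤ a) ↔ (i ≤ b ↔ j ≤ b))

instance (P : Finset (Finset α)) : DecidableRel (CutRight P) := fun _ _ => by
  unfold CutRight; infer_instance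

instance (P : Finset (Finset α)) : DecidableRel (CutLeft P) := fun _ _ => by
  unfold CutLeft; infer_instance

theorem cutRight_iff {P : Finset (Finset α)} {i j : α} :
    CutRight P i j ↔ ∀ a b, SameBlock P a b → ((a ≤ i ↔ a ≤ j) ↔ (b ≤ i ↔ b ≤ j)) :=
  ⟨fun h a b ⟨U, hU, ha, hb⟩ => h U hU a ha b hb, fun h U hU a ha b hb => h a b ⟨U, hU, ha, hb⟩⟩

theorem cutLeft_iff {P : Finset (Finset α)} {i j : α} :
    CutLeft P i j ↔ ∀ a b, SameBlock P a b → ((i ≤ a ↔ j ≤ a) ↔ (i ≤ b ↔ j ≤ b)) :=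
  ⟨fun h a b ⟨U, hU, ha, hb⟩ => h U hU a ha b hb, fun h U hU a ha b hb => h a b ⟨U, hU, ha, hb⟩⟩

/-- The condition `a ≤ i ↔ a ≤ j` is a parity in `i` and `j`, and parities add along `i, j, k`. No
order between `i` and `j` is therefore needed. -/
theorem cutRight_equivalence (P : Finset (Finset α)) : Equivalence (CutRight P) where
  refl i U _ a _ b _ := by simp
  symm h U hU a ha b hb := by have := h U hU a ha b hb; tauto
  trans h h' U hU a ha b hb := by
    have h1 := h U hU a ha b hb
    have h2 := h' U hU a ha b hb
    tauto

theorem cutLeft_equivalence (P : Finset (Finset α)) : Equivalence (CutLeft P) where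
  refl i U _ a _ b _ := by simp
  symm h U hU a ha b hb := by have := h U hU a ha b hb; tauto
  trans h h' U hU a ha b hb := by
    have h1 := h U hU a ha b hb
    have h2 := h' U hU a ha b hb
    tauto

/-- The Kreweras complement of the partition `P` of `V`. -/
def kr (V : Finset α) (P : Finset (Finset α)) : Finset (Finset α) := classesOn V (CutRight P)

/-- The inverse Kreweras complement of the partition `P` of `V`. -/
def krInv (V : Finset α) (P : Finset (Finset α)) : Finset (Finset α) := classesOn V (CutLeft P)

theorem sameBlock_kr {V : Finset α} {P : Finset (Finset α)} {i j : α} :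
    SameBlock (kr V P) i j ↔ i ∈ V ∧ j ∈ V ∧
      ∀ a b, SameBlock P a b → ((a ≤ i ↔ a ≤ j) ↔ (b ≤ i ↔ b ≤ j)) := by
  rw [kr, sameBlock_classesOn (cutRight_equivalence P), cutRight_iff]

theorem sameBlock_krInv {V : Finset α} {P : Finset (Finset α)} {i j : α} :
    SameBlock (krInv V P) i j ↔ i ∈ V ∧ j ∈ V ∧
      ∀ a b, SameBlock P a b → ((i ≤ a ↔ j ≤ a) ↔ (i ≤ b ↔ j ≤ b)) := by
  rw [krInv, sameBlock_classesOn (cutLeft_equivalence P), cutLeft_iff]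

/-- For `p₁ < q₁ < p₂ < q₂` one has `(p₁, q₁] = (p₁, p₂] \ (q₁, q₂]`, so a block cut by neither
interval on the right is not cut by their difference. -/
theorem isNCPartition_kr (V : Finset α) (P : Finset (Finset α)) : IsNCPartition V (kr V P) := by
  refine isNCPartition_classesOn (cutRight_equivalence P) ?_
  intro p₁ q₁ p₂ q₂ h₁ h₂ h₃ hp hq U hU a ha b hb
  have e1 := hp U hU a ha b hb
  have e2 := hq U hU a ha b hb
  grind

theorem isNCPartition_krInv (V : Finset α) (P : Finset (Finset α)) :
    IsNCPartition V (krInv V P) := by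
  refine isNCPartition_classesOn (cutLeft_equivalence P) ?_
  intro p₁ q₁ p₂ q₂ h₁ h₂ h₃ hp hq U hU a ha b hb
  have e1 := hp U hU a ha b hb
  have e2 := hq U hU a ha b hb
  grind

/-- The cut condition is symmetric: `(i, j)` leaves `a, b` unseparated exactly when `(a, b)`, read
from the left, leaves `i, j` unseparated. -/
theorem sameBlock_krInv_kr_of_sameBlock {V : Finset α} {P : Finset (Finset α)}
    (hP : IsNCPartition V P) {i j : α} (h : SameBlock P i j) :
    SameBlock (krInv V (kr V P)) i j := by
  rw [sameBlock_krInv]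
  refine ⟨hP.mem_left h, hP.mem_right h, fun a b hab => ?_⟩
  have := (sameBlock_kr.1 hab).2.2 i j h
  tauto

theorem exists_isPred {V : Finset α} {k b : α} (hk : k ∈ V) (hkb : k < b) :
    ∃ l ∈ V, l < b ∧ ∀ x ∈ V, x < b → x ≤ l := by
  have hne : (V.filter (· < b)).Nonempty := ⟨k, by simp [hk, hkb]⟩
  refine ⟨(V.filter (· < b)).max' hne, ?_, ?_, fun x hx hxb => ?_⟩
  · exact (Finset.mem_filter.1 (Finset.max'_mem _ hne)).1
  · exact (Finset.mem_filter.1 (Finset.max'_mem _ hne)).2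
  · exact Finset.le_max' _ _ (by simp [hx, hxb])

theorem exists_isSucc {V : Finset α} {k b : α} (hk : k ∈ V) (hkb : b < k) :
    ∃ l ∈ V, b < l ∧ ∀ x ∈ V, b < x → l ≤ x := by
  have hne : (V.filter (b < ·)).Nonempty := ⟨k, by simp [hk, hkb]⟩
  refine ⟨(V.filter (b < ·)).min' hne, ?_, ?_, fun x hx hxb => ?_⟩
  · exact (Finset.mem_filter.1 (Finset.min'_mem _ hne)).1
  · exact (Finset.mem_filter.1 (Finset.min'_mem _ hne)).2
  · exact Finset.min'_le _ _ (by simp [hx, hxb])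

/-- Two elements in different blocks are separated by a pair of elements in one block of the
Kreweras complement. -/
theorem not_sameBlock_krInv_kr {V : Finset α} {P : Finset (Finset α)}
    (hP : IsNCPartition V P) {i j : α} (hij : i < j) (hi : i ∈ V) (hj : j ∈ V)
    (h : ¬ SameBlock P i j) : ¬ SameBlock (krInv V (kr V P)) i j := by
  obtain ⟨B, hB, hjB⟩ := hP.2.1 j hj
  have hBV := (hP.1 B hB).2
  have hmem := hP.mem_iff_sameBlock hB hjB
  have hiB : i ∉ B := fun hiB => h ⟨B, hB, hiB, hjB⟩
  suffices ∃ k l, SameBlock (kr V P) k l ∧ ¬ ((i ≤ k ↔ j ≤ k) ↔ (i ≤ l ↔ j ≤ l)) by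
    obtain ⟨k, l, hkl, hn⟩ := this
    exact fun hc => hn ((sameBlock_krInv.1 hc).2.2 k l hkl)
  -- If the block `B` of `j` has points below `i`, then `i` lies in a gap of `B` between neighbours
  -- `a < i < b`. The points of `V` inside this gap form a union of blocks, so `a` and the
  -- predecessor `l` of `b` are joined in `kr V P`.
  by_cases hc : ∃ c ∈ B, c < i
  · obtain ⟨c, hcB, hci⟩ := hc
    obtain ⟨a, haB, hai, ha⟩ := exists_isPred hcB hci
    obtain ⟨b, hbB, hib, hb⟩ := exists_isSucc hjB hij
    obtain ⟨l, hlV, hlb, hl⟩ := exists_isPred hi hib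
    have hil := hl i hi hib
    have hbj := hb j hjB hij
    have key : ∀ x y, SameBlock P x y → a < x → x ≤ l → a < y ∧ y ≤ l := by
      intro x y hxy hax hxl
      have hxB : x ∉ B := fun hx => by
        rcases lt_trichotomy x i with hlt | rfl | hlt
        · exact absurd (ha x hx hlt) (not_le.2 hax)
        · exact hiB hx
        · exact absurd (hb x hx hlt) (not_le.2 (hxl.trans_lt hlb))
      have hab : SameBlock P a b := ⟨B, hB, haB, hbB⟩
      have haj : SameBlock P j a := ⟨B, hB, hjB, haB⟩
      have hxa : ¬ SameBlock P a x := fun hax => hxB ((hmem x).2 (hP.trans haj hax))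
      have hya : ¬ SameBlock P y a := fun hya => hxa (hP.trans hxy hya).symm
      constructor
      · by_contra hya'
        rcases (not_lt.1 hya').lt_or_eq with hlt | rfl
        · exact hya (hP.nc hlt hax (hxl.trans_lt hlb) hxy.symm hab)
        · exact hxa hxy.symm
      · refine hl y (hP.mem_right hxy) ?_
        by_contra hyb
        rcases (not_lt.1 hyb).lt_or_eq with hlt | rfl
        · exact hxa (hP.nc hax (hxl.trans_lt hlb) hlt hab hxy)
        · exact hya hab.symm
    refine ⟨a, l, sameBlock_kr.2 ⟨hBV haB, hlV, fun x y hxy => ?_⟩, ?_⟩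
    · have h1 := key x y hxy
      have h2 := key y x hxy.symm
      grind
    · grind
  -- Now `B` lies above `i`. Its convex hull is a union of blocks, so the predecessor `k` of its
  -- minimum is joined in `kr V P` to its maximum `l`.
  · push Not at hc
    have hne : B.Nonempty := ⟨j, hjB⟩
    have hlB := B.max'_mem hne
    have hmB := B.min'_mem hne
    have hl : ∀ x ∈ B, x ≤ B.max' hne := fun x hx => B.le_max' x hx
    have hm : ∀ x ∈ B, B.min' hne ≤ x := fun x hx => B.min'_le x hx
    generalize B.max' hne = l at *
    generalize B.min' hne = m at *
    have him : i < m := lt_of_le_of_ne (hc m hmB) fun h => hiB (h ▸ hmB)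
    obtain ⟨k, hkV, hkm, hk⟩ := exists_isPred hi him
    have hik := hk i hi him
    have hjl := hl j hjB
    have hmj := hm j hjB
    have hml : SameBlock P m l := ⟨B, hB, hmB, hlB⟩
    have key : ∀ x y, SameBlock P x y → k < x → x ≤ l → k < y ∧ y ≤ l := by
      intro x y hxy hkx hxl
      have hmx : m ≤ x := by
        by_contra hxm
        exact absurd (hk x (hP.mem_left hxy) (not_le.1 hxm)) (not_le.2 hkx)
      suffices m ≤ y ∧ y ≤ l from ⟨hkm.trans_le this.1, this.2⟩
      by_cases hxB : x ∈ B
      · have hyB : y ∈ B := (hP.mem_iff_sameBlock hB hxB y).2 hxy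
        exact ⟨hm y hyB, hl y hyB⟩
      · have hmx' : m < x := lt_of_le_of_ne hmx fun h => hxB (h ▸ hmB)
        have hxl' : x < l := lt_of_le_of_ne hxl fun h => hxB (h ▸ hlB)
        have hnot : ¬ SameBlock P m x := fun h =>
          hxB ((hP.mem_iff_sameBlock hB hmB x).2 h)
        constructor
        · by_contra hym
          exact hnot (hP.trans (hP.nc (not_le.1 hym) hmx' hxl' hxy.symm hml).symm hxy.symm)
        · by_contra hyl
          exact hnot (hP.nc hmx' hxl' (not_le.1 hyl) hml hxy)
    refine ⟨k, l, sameBlock_kr.2 ⟨hkV, hBV hlB, fun x y hxy => ?_⟩, ?_⟩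
    · have h1 := key x y hxy
      have h2 := key y x hxy.symm
      grind
    · grind

theorem krInv_kr {V : Finset α} {P : Finset (Finset α)} (hP : IsNCPartition V P) :
    krInv V (kr V P) = P := by
  have hK := isNCPartition_krInv V (kr V P)
  refine hK.ext hP fun x y => ⟨fun h => ?_, sameBlock_krInv_kr_of_sameBlock hP⟩
  by_contra hn
  have hx := hK.mem_left h
  have hy := hK.mem_right h
  rcases lt_trichotomy x y with hlt | rfl | hlt
  · exact not_sameBlock_krInv_kr hP hlt hx hy hn h
  · exact hn (hP.refl hx)
  · exact not_sameBlock_krInv_kr hP hlt hy hx (fun h' => hn h'.symm) h.symm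

/-- The non-crossing partitions of a finite subset of a linear order. -/
def ncPartitions (V : Finset α) : Finset (Finset (Finset α)) :=
  V.powerset.powerset.filter (IsNCPartition V)

theorem mem_ncPartitions {V : Finset α} {P : Finset (Finset α)} :
    P ∈ ncPartitions V ↔ IsNCPartition V P := by
  simp only [ncPartitions, Finset.mem_filter, Finset.mem_powerset, and_iff_right_iff_imp]
  exact fun h U hU => Finset.mem_powerset.2 (h.1 U hU).2

theorem kr_injOn (V : Finset α) : Set.InjOn (kr V) {P | IsNCPartition V P} := by
  intro P hP Q hQ h
  rw [← krInv_kr hP, h, krInv_kr hQ]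

/-- `kr V` is an injective self-map of the finite set `ncPartitions V`. -/
theorem exists_kr_eq {V : Finset α} {Q : Finset (Finset α)} (hQ : IsNCPartition V Q) :
    ∃ P, IsNCPartition V P ∧ kr V P = Q := by
  obtain ⟨P, hP, h⟩ := Finset.surj_on_of_inj_on_of_card_le (s := ncPartitions V)
    (t := ncPartitions V) (fun P _ => kr V P)
    (fun P _ => mem_ncPartitions.2 (isNCPartition_kr V P))
    (fun P Q hP hQ h => kr_injOn V (mem_ncPartitions.1 hP) (mem_ncPartitions.1 hQ) h)
    le_rfl Q (mem_ncPartitions.2 hQ)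
  exact ⟨P, mem_ncPartitions.1 hP, h.symm⟩

theorem kr_krInv {V : Finset α} {Q : Finset (Finset α)} (hQ : IsNCPartition V Q) :
    kr V (krInv V Q) = Q := by
  obtain ⟨P, hP, rfl⟩ := exists_kr_eq hQ
  rw [krInv_kr hP]

/-! ### Refinement and relative complements -/

/-- Every block of `P` is contained in a block of `Q`. -/
def Refines (P Q : Finset (Finset α)) : Prop := ∀ U ∈ P, ∃ W ∈ Q, U ⊆ W

theorem refines_iff {V : Finset α} {P Q : Finset (Finset α)} (hP : IsNCPartition V P)
    (hQ : IsNCPartition V Q) : Refines P Q ↔ ∀ x y, SameBlock P x y → SameBlock Q x y := by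
  constructor
  · rintro h x y ⟨U, hU, hx, hy⟩
    obtain ⟨W, hW, hUW⟩ := h U hU
    exact ⟨W, hW, hUW hx, hUW hy⟩
  · intro h U hU
    obtain ⟨x, hx⟩ := (hP.1 U hU).1
    obtain ⟨W, hW, hxW⟩ := hQ.2.1 x ((hP.1 U hU).2 hx)
    exact ⟨W, hW, fun y hy => (hQ.mem_iff_sameBlock hW hxW y).2 (h x y ⟨U, hU, hx, hy⟩)⟩

/-- The blocks of `P` inside `B`. -/
def blocksIn (P : Finset (Finset α)) (B : Finset α) : Finset (Finset α) := P.filter (· ⊆ B)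

/-- The union of partitions of the blocks of `P`. -/
def glue (P : Finset (Finset α)) (p : P → Finset (Finset α)) : Finset (Finset α) :=
  Finset.univ.biUnion p

theorem sameBlock_glue {P : Finset (Finset α)} {p : P → Finset (Finset α)} {x y : α} :
    SameBlock (glue P p) x y ↔ ∃ B, SameBlock (p B) x y := by
  simp only [SameBlock, glue, Finset.mem_biUnion, Finset.mem_univ, true_and]
  constructor
  · rintro ⟨U, ⟨B, hB⟩, h⟩
    exact ⟨B, U, hB, h⟩
  · rintro ⟨B, U, hB, h⟩
    exact ⟨U, ⟨B, hB⟩, h⟩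

theorem IsNCPartition.glue {V : Finset α} {P : Finset (Finset α)} (hP : IsNCPartition V P)
    {p : P → Finset (Finset α)} (hp : ∀ B : P, IsNCPartition (B : Finset α) (p B)) :
    IsNCPartition V (glue P p) := by
  simp only [IsNCPartition, _root_.glue, Finset.mem_biUnion, Finset.mem_univ, true_and,
    forall_exists_index]
  refine ⟨fun U B hU => ⟨((hp B).1 U hU).1, ((hp B).1 U hU).2.trans (hP.1 B B.2).2⟩, ?_, ?_, ?_⟩
  · intro x hx
    obtain ⟨B, hB, hxB⟩ := hP.2.1 x hx
    obtain ⟨U, hU, hxU⟩ := (hp ⟨B, hB⟩).2.1 x hxB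
    exact ⟨U, ⟨_, hU⟩, hxU⟩
  · intro U B hU W C hW x hxU hxW
    obtain rfl : B = C := Subtype.ext
      (hP.eq_of_mem B.2 C.2 (((hp B).1 U hU).2 hxU) (((hp C).1 W hW).2 hxW))
    exact (hp B).eq_of_mem hU hW hxU hxW
  · intro U B hU W C hW p₁ hp₁ q₁ hq₁ p₂ hp₂ q₂ hq₂ h₁ h₂ h₃
    have hUB := ((hp B).1 U hU).2
    have hWC := ((hp C).1 W hW).2
    obtain rfl : B = C := Subtype.ext (hP.2.2.2 B B.2 C C.2 p₁ (hUB hp₁) q₁ (hWC hq₁)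
      p₂ (hUB hp₂) q₂ (hWC hq₂) h₁ h₂ h₃)
    exact (hp B).2.2.2 U hU W hW p₁ hp₁ q₁ hq₁ p₂ hp₂ q₂ hq₂ h₁ h₂ h₃

theorem refines_glue {P : Finset (Finset α)} {p : P → Finset (Finset α)}
    (hp : ∀ B : P, IsNCPartition (B : Finset α) (p B)) : Refines (glue P p) P := by
  intro U hU
  obtain ⟨B, -, hB⟩ := Finset.mem_biUnion.1 hU
  exact ⟨B, B.2, ((hp B).1 U hB).2⟩

theorem sameBlock_blocksIn {V : Finset α} {P Q : Finset (Finset α)} (hP : IsNCPartition V P)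
    (h : Refines Q P) {B : Finset α} (hB : B ∈ P) {x y : α} :
    SameBlock (blocksIn Q B) x y ↔ SameBlock Q x y ∧ x ∈ B := by
  simp only [SameBlock, blocksIn, Finset.mem_filter]
  constructor
  · rintro ⟨U, ⟨hU, hUB⟩, hx, hy⟩
    exact ⟨⟨U, hU, hx, hy⟩, hUB hx⟩
  · rintro ⟨⟨U, hU, hx, hy⟩, hxB⟩
    obtain ⟨W, hW, hUW⟩ := h U hU
    obtain rfl := hP.eq_of_mem hW hB (hUW hx) hxB
    exact ⟨U, ⟨hU, hUW⟩, hx, hy⟩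

theorem IsNCPartition.blocksIn {V : Finset α} {P Q : Finset (Finset α)}
    (hP : IsNCPartition V P) (hQ : IsNCPartition V Q) (h : Refines Q P) {B : Finset α}
    (hB : B ∈ P) : IsNCPartition B (blocksIn Q B) := by
  simp only [IsNCPartition, _root_.blocksIn, Finset.mem_filter]
  refine ⟨fun U hU => ⟨(hQ.1 U hU.1).1, hU.2⟩, fun x hx => ?_,
    fun U hU W hW => hQ.2.2.1 U hU.1 W hW.1, fun U hU W hW => hQ.2.2.2 U hU.1 W hW.1⟩
  obtain ⟨U, hU, hxU⟩ := hQ.2.1 x ((hP.1 B hB).2 hx)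
  obtain ⟨W, hW, hUW⟩ := h U hU
  obtain rfl := hP.eq_of_mem hW hB (hUW hxU) hx
  exact ⟨U, ⟨hU, hUW⟩, hxU⟩

theorem glue_blocksIn {P Q : Finset (Finset α)} (h : Refines Q P) :
    glue P (fun B => blocksIn Q B) = Q := by
  ext U
  simp only [glue, blocksIn, Finset.mem_biUnion, Finset.mem_univ, true_and, Finset.mem_filter]
  refine ⟨fun ⟨_, hU, _⟩ => hU, fun hU => ?_⟩
  obtain ⟨W, hW, hUW⟩ := h U hU
  exact ⟨⟨W, hW⟩, hU, hUW⟩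

theorem blocksIn_glue {V : Finset α} {P : Finset (Finset α)} (hP : IsNCPartition V P)
    {p : P → Finset (Finset α)} (hp : ∀ B : P, IsNCPartition (B : Finset α) (p B)) (B : P) :
    blocksIn (glue P p) B = p B := by
  ext U
  simp only [glue, blocksIn, Finset.mem_biUnion, Finset.mem_univ, true_and, Finset.mem_filter]
  constructor
  · rintro ⟨⟨C, hU⟩, hUB⟩
    obtain ⟨x, hx⟩ := ((hp C).1 U hU).1
    obtain rfl : C = B := Subtype.ext
      (hP.eq_of_mem C.2 B.2 (((hp C).1 U hU).2 hx) (hUB hx))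
    exact hU
  · exact fun hU => ⟨⟨B, hU⟩, ((hp B).1 U hU).2⟩

/-- The Kreweras complement of `Q` relative to a coarser partition `P`. -/
def relKr (P Q : Finset (Finset α)) : Finset (Finset α) :=
  glue P fun B => kr B (blocksIn Q B)

theorem isNCPartition_relKr {V : Finset α} {P : Finset (Finset α)} (hP : IsNCPartition V P)
    (Q : Finset (Finset α)) : IsNCPartition V (relKr P Q) :=
  hP.glue fun _ => isNCPartition_kr _ _

theorem refines_relKr (P Q : Finset (Finset α)) : Refines (relKr P Q) P :=
  refines_glue fun _ => isNCPartition_kr _ _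

theorem sameBlock_relKr {V : Finset α} {P Q : Finset (Finset α)} (hP : IsNCPartition V P)
    (h : Refines Q P) {i j : α} :
    SameBlock (relKr P Q) i j ↔ SameBlock P i j ∧
      ∀ a b, SameBlock Q a b → SameBlock P i a → ((a ≤ i ↔ a ≤ j) ↔ (b ≤ i ↔ b ≤ j)) := by
  simp only [relKr, sameBlock_glue, sameBlock_kr]
  constructor
  · rintro ⟨B, hi, hj, hij⟩
    refine ⟨⟨B, B.2, hi, hj⟩, fun a b hab hia => hij a b ?_⟩
    exact (sameBlock_blocksIn hP h B.2).2 ⟨hab, (hP.mem_iff_sameBlock B.2 hi a).2 hia⟩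
  · rintro ⟨⟨B, hB, hi, hj⟩, hij⟩
    refine ⟨⟨B, hB⟩, hi, hj, fun a b hab => ?_⟩
    obtain ⟨hab, ha⟩ := (sameBlock_blocksIn hP h hB).1 hab
    exact hij a b hab ⟨B, hB, hi, ha⟩

theorem relKr_injective {V : Finset α} {P Q Q' : Finset (Finset α)} (hP : IsNCPartition V P)
    (hQ : IsNCPartition V Q) (hQ' : IsNCPartition V Q') (h : Refines Q P) (h' : Refines Q' P)
    (heq : relKr P Q = relKr P Q') : Q = Q' := by
  rw [← glue_blocksIn h, ← glue_blocksIn h']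
  congr 1
  funext B
  refine kr_injOn (B : Finset α) (hP.blocksIn hQ h B.2) (hP.blocksIn hQ' h' B.2) ?_
  rw [← blocksIn_glue hP (p := fun B => kr B (blocksIn Q B)) (fun _ => isNCPartition_kr _ _) B,
    ← blocksIn_glue hP (p := fun B => kr B (blocksIn Q' B)) (fun _ => isNCPartition_kr _ _) B]
  exact congrArg (blocksIn · (B : Finset α)) heq

/-- Recover `P` as `krInv V (kr V P)`: a pair joined in `kr V P` is joined in `kr V Q`, so it cannot
separate two points of one block of `Q`. -/
theorem refines_of_kr_refines {V : Finset α} {P Q : Finset (Finset α)} (hP : IsNCPartition V P)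
    (hQ : IsNCPartition V Q) (h : Refines (kr V P) (kr V Q)) : Refines Q P := by
  rw [refines_iff (isNCPartition_kr _ _) (isNCPartition_kr _ _)] at h
  rw [refines_iff hQ hP]
  intro x y hxy
  rw [← krInv_kr hP, sameBlock_krInv]
  refine ⟨hQ.mem_left hxy, hQ.mem_right hxy, fun a b hab => ?_⟩
  have := (sameBlock_kr.1 (h a b hab)).2.2 x y hxy
  tauto

theorem relKr_refines_kr {V : Finset α} {P Q : Finset (Finset α)} (hP : IsNCPartition V P)
    (hQ : IsNCPartition V Q) (h : Refines Q P) : Refines (relKr P Q) (kr V Q) := by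
  rw [refines_iff (isNCPartition_relKr hP Q) (isNCPartition_kr _ _)]
  intro i j hij
  rw [sameBlock_relKr hP h] at hij
  obtain ⟨hij, hcut⟩ := hij
  refine sameBlock_kr.2 ⟨hP.mem_left hij, hP.mem_right hij, fun a b hab => ?_⟩
  by_cases hia : SameBlock P i a
  · exact hcut a b hab hia
  · have hab' := (refines_iff hQ hP).1 h a b hab
    have hib : ¬ SameBlock P i b := fun hib => hia (hP.trans hib hab'.symm)
    have hja : ¬ SameBlock P j a := fun hja => hia (hP.trans hij hja)
    have hjb : ¬ SameBlock P j b := fun hjb => hib (hP.trans hij hjb)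
    have ne : ∀ x y, ¬ SameBlock P x y → SameBlock P x x → x ≠ y := by
      rintro x y hxy hxx rfl
      exact hxy hxx
    have ii := hP.refl (hP.mem_left hij)
    have jj := hP.refl (hP.mem_right hij)
    have e1 := ne _ _ hia ii
    have e2 := ne _ _ hib ii
    have e3 := ne _ _ hja jj
    have e4 := ne _ _ hjb jj
    -- Here `i, j` and `a, b` lie in two different blocks of `P`; the eight facts exclude every
    -- crossing of the two pairs.
    have n1 : ¬ (i < a ∧ a < j ∧ j < b) := fun h => hia (hP.nc h.1 h.2.1 h.2.2 hij hab')
    have n2 : ¬ (i < b ∧ b < j ∧ j < a) := fun h => hib (hP.nc h.1 h.2.1 h.2.2 hij hab'.symm)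
    have n3 : ¬ (j < a ∧ a < i ∧ i < b) := fun h => hja (hP.nc h.1 h.2.1 h.2.2 hij.symm hab')
    have n4 : ¬ (j < b ∧ b < i ∧ i < a) :=
      fun h => hjb (hP.nc h.1 h.2.1 h.2.2 hij.symm hab'.symm)
    have n5 : ¬ (a < i ∧ i < b ∧ b < j) := fun h => hia (hP.nc h.1 h.2.1 h.2.2 hab' hij).symm
    have n6 : ¬ (b < i ∧ i < a ∧ a < j) :=
      fun h => hib (hP.nc h.1 h.2.1 h.2.2 hab'.symm hij).symm
    have n7 : ¬ (a < j ∧ j < b ∧ b < i) :=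
      fun h => hja (hP.nc h.1 h.2.1 h.2.2 hab' hij.symm).symm
    have n8 : ¬ (b < j ∧ j < a ∧ a < i) :=
      fun h => hjb (hP.nc h.1 h.2.1 h.2.2 hab'.symm hij.symm).symm
    clear ne hia hib hja hjb hij hab' ii jj hcut hab
    grind

theorem exists_greatest {B : Finset α} {p : α → Prop} (h : ∃ x ∈ B, p x) :
    ∃ m ∈ B, p m ∧ ∀ x ∈ B, p x → x ≤ m := by
  classical
  obtain ⟨x, hx, hpx⟩ := h
  obtain ⟨m, hm, hmax⟩ := (B.filter p).exists_max_image id ⟨x, by simp [hx, hpx]⟩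
  rw [Finset.mem_filter] at hm
  exact ⟨m, hm.1, hm.2, fun y hy hpy => hmax y (by simp [hy, hpy])⟩

/-- The hard half of `relKr_kr_relKr`. If a block `B` of `P` were cut by `(i, j]`, some `a'` inside
and `b'` outside this interval would share a block of `relKr P Q` lying in the `kr V Q`-block of
`i`, against the relative cut condition. -/
theorem cut_of_sameBlock_relKr {V : Finset α} {P Q : Finset (Finset α)}
    (hP : IsNCPartition V P) (hQ : IsNCPartition V Q) (h : Refines Q P) {i j : α} (hij : i < j)
    (hr : SameBlock (relKr (kr V Q) (relKr P Q)) i j) {a b : α} (hab : SameBlock P a b)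
    (hia : i < a) (haj : a ≤ j) : i < b ∧ b ≤ j := by
  have hK := isNCPartition_kr V Q
  have hR := isNCPartition_relKr hP Q
  have hRK := relKr_refines_kr hP hQ h
  rw [sameBlock_relKr hK hRK] at hr
  obtain ⟨hKij, hcut⟩ := hr
  have hQij := (sameBlock_kr.1 hKij).2.2
  by_contra hb
  obtain ⟨B, hB, haB, hbB⟩ := hab
  obtain ⟨a', ha'B, ⟨hia', haj'⟩, ha'⟩ :=
    exists_greatest (p := fun x => i < x ∧ x ≤ j) ⟨a, haB, hia, haj⟩
  -- The first alternative says that `a'` and `b'` cut `B` exactly as `(i, j]` does, up to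
  -- complement; since `Q` is not cut by `(i, j]`, this joins them in `relKr P Q`. The second writes
  -- `(i, a']` as an intersection or a difference of uncut intervals, which joins `i` to `a'` in `kr
  -- V Q`.
  have key : ∀ b' ∈ B, ¬ (i < b' ∧ b' ≤ j) →
      ((∀ c ∈ B, (c ≤ b' ↔ c ≤ a') ↔ (c ≤ i ↔ c ≤ j)) ∨
        (∀ c ∈ B, (c ≤ b' ↔ c ≤ a') ↔ ¬ (c ≤ i ↔ c ≤ j))) →
      (∀ c, (c ≤ i ↔ c ≤ a') ↔ ((c ≤ i ↔ c ≤ j) ∨ (c ≤ b' ↔ c ≤ a'))) ∨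
      (∀ c, (c ≤ i ↔ c ≤ a') ↔ ((c ≤ i ↔ c ≤ j) ∨ ¬ (c ≤ b' ↔ c ≤ a'))) → False := by
    intro b' hb'B hb' h1 h2
    have hRab : SameBlock (relKr P Q) b' a' := by
      rw [sameBlock_relKr hP h]
      refine ⟨⟨B, hB, hb'B, ha'B⟩, fun c d hcd hbc => ?_⟩
      have hcB : c ∈ B := (hP.mem_iff_sameBlock hB hb'B c).2 hbc
      have hdB : d ∈ B := (hP.mem_iff_sameBlock hB hcB d).2 ((refines_iff hQ hP).1 h c d hcd)
      rcases h1 with h1 | h1 <;> rw [h1 c hcB, h1 d hdB, hQij c d hcd]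
    have hKab := (refines_iff hR hK).1 hRK _ _ hRab
    have hKia : SameBlock (kr V Q) i a' := by
      refine sameBlock_kr.2 ⟨hK.mem_left hKij, hK.mem_right hKab, fun c d hcd => ?_⟩
      have e1 := hQij c d hcd
      have e2 := (sameBlock_kr.1 hKab).2.2 c d hcd
      rcases h2 with h2 | h2
      · rw [h2 c, h2 d, e1, e2]
      · rw [h2 c, h2 d, e1, e2]
    have := hcut a' b' hRab.symm hKia
    clear hcut h1 h2
    grind
  -- `b'` is the last point of `B` before `(i, j]` in the cyclic order: the greatest one up to `i`
  -- or, failing that, the maximum of `B`, which lies beyond `j`.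
  by_cases hex : ∃ y ∈ B, y ≤ i
  · obtain ⟨b', hb'B, hbi', hb'⟩ := exists_greatest hex
    refine key b' hb'B (by grind) (Or.inl fun c hc => ?_) (Or.inl fun c => ?_)
    · have h1 := ha' c hc
      have h2 := hb' c hc
      grind
    · grind
  · push Not at hex
    obtain ⟨b', hb'B, -, hb'⟩ := exists_greatest (p := fun _ => True) ⟨b, hbB, trivial⟩
    have h3 := hb' b hbB trivial
    have h4 := hex b hbB
    refine key b' hb'B (by grind) (Or.inr fun c hc => ?_) (Or.inr fun c => ?_)
    · have h1 := ha' c hc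
      have h2 := hb' c hc trivial
      have h5 := hex c hc
      grind
    · grind

/-- Viewing partitions as permutations with the blocks as increasing cycles, and `c` as the full
cycle, `kr V P` is `P⁻¹c` and `relKr P Q` is `Q⁻¹P`; the identity reads `(Q⁻¹P)⁻¹(Q⁻¹c) = P⁻¹c`. -/
theorem relKr_kr_relKr {V : Finset α} {P Q : Finset (Finset α)} (hP : IsNCPartition V P)
    (hQ : IsNCPartition V Q) (h : Refines Q P) : relKr (kr V Q) (relKr P Q) = kr V P := by
  have hK := isNCPartition_kr V Q
  have hR := isNCPartition_relKr hP Q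
  have hRK := relKr_refines_kr hP hQ h
  refine (isNCPartition_relKr hK _).ext (isNCPartition_kr V P) fun i j => ⟨fun hr => ?_, fun hr => ?_⟩
  · have hi := (isNCPartition_relKr hK _).mem_left hr
    have hj := (isNCPartition_relKr hK _).mem_right hr
    refine sameBlock_kr.2 ⟨hi, hj, fun a b hab => ?_⟩
    rcases lt_trichotomy i j with hij | rfl | hij
    · have h1 := cut_of_sameBlock_relKr hP hQ h hij hr hab
      have h2 := cut_of_sameBlock_relKr hP hQ h hij hr hab.symm
      grind
    · simp
    · have h1 := cut_of_sameBlock_relKr hP hQ h hij hr.symm hab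
      have h2 := cut_of_sameBlock_relKr hP hQ h hij hr.symm hab.symm
      grind
  · obtain ⟨hi, hj, hcut⟩ := sameBlock_kr.1 hr
    rw [sameBlock_relKr hK hRK]
    refine ⟨sameBlock_kr.2 ⟨hi, hj, fun a b hab => ?_⟩, fun a b hab _ => ?_⟩
    · exact hcut a b ((refines_iff hQ hP).1 h a b hab)
    · exact hcut a b ((refines_iff hR hP).1 (refines_relKr P Q) a b hab)

/-- `relKr · Q` maps the partitions coarser than `Q` onto those finer than `kr V Q`. -/
theorem exists_relKr_eq {V : Finset α} {Q R : Finset (Finset α)} (hQ : IsNCPartition V Q)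
    (hR : IsNCPartition V R) (h : Refines R (kr V Q)) :
    ∃ P, IsNCPartition V P ∧ Refines Q P ∧ relKr P Q = R := by
  have hK := isNCPartition_kr V Q
  -- By `relKr_kr_relKr`, the required `P` must satisfy `kr V P = relKr (kr V Q) R`.
  obtain ⟨P, hP, hPR⟩ := exists_kr_eq (isNCPartition_relKr hK R)
  have hQP : Refines Q P := refines_of_kr_refines hP hQ (hPR ▸ refines_relKr _ _)
  refine ⟨P, hP, hQP, ?_⟩
  refine relKr_injective hK (isNCPartition_relKr hP Q) hR (relKr_refines_kr hP hQ hQP) h ?_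
  rw [relKr_kr_relKr hP hQ hQP, hPR]

end NCPartitions

/-! ### Images of block families under embeddings. -/

section MapBlocks

variable {α β : Type*}

/-- The image of a family of blocks. -/
def mapBlocks (e : α ↪ β) (P : Finset (Finset α)) : Finset (Finset β) :=
  P.map (Finset.mapEmbedding e).toEmbedding

theorem mem_mapBlocks {e : α ↪ β} {P : Finset (Finset α)} {W : Finset β} :
    W ∈ mapBlocks e P ↔ ∃ U ∈ P, U.map e = W := by
  simp [mapBlocks]

theorem mapBlocks_injective (e : α ↪ β) : Function.Injective (mapBlocks e) :=
  Finset.map_injective _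

theorem prod_mapBlocks {R : Type*} [CommRing R] (e : α ↪ β) (P : Finset (Finset α))
    (φ : Finset β → R) : ∏ W ∈ mapBlocks e P, φ W = ∏ U ∈ P, φ (U.map e) := by
  simp [mapBlocks]

theorem sameBlock_mapBlocks {e : α ↪ β} {P : Finset (Finset α)} {x y : α} :
    SameBlock (mapBlocks e P) (e x) (e y) ↔ SameBlock P x y := by
  simp [SameBlock, mem_mapBlocks]

theorem forall_sameBlock_mapBlocks {e : α ↪ β} {P : Finset (Finset α)} {p : β → β → Prop} :
    (∀ x y, SameBlock (mapBlocks e P) x y → p x y) ↔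
      ∀ x y, SameBlock P x y → p (e x) (e y) := by
  constructor
  · exact fun h x y hxy => h _ _ (sameBlock_mapBlocks.2 hxy)
  · rintro h x y ⟨W, hW, hx, hy⟩
    obtain ⟨U, hU, rfl⟩ := mem_mapBlocks.1 hW
    obtain ⟨a, ha, rfl⟩ := Finset.mem_map.1 hx
    obtain ⟨b, hb, rfl⟩ := Finset.mem_map.1 hy
    exact h a b ⟨U, hU, ha, hb⟩

end MapBlocks

/-! ### Convolution of functions on finite sets, and its associativity. -/

section Convolution

variable {α β : Type*} [LinearOrder α] [LinearOrder β] {R : Type*} [CommRing R]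

/-- The boxed convolution of two functions on finite subsets of a linear order. -/
def conv (φ ψ : Finset α → R) (V : Finset α) : R :=
  ∑ P ∈ ncPartitions V, (∏ U ∈ P, φ U) * ∏ U ∈ kr V P, ψ U

theorem prod_glue {V : Finset α} {P : Finset (Finset α)} (hP : IsNCPartition V P)
    {p : P → Finset (Finset α)} (hp : ∀ B : P, IsNCPartition (B : Finset α) (p B))
    (φ : Finset α → R) : ∏ U ∈ glue P p, φ U = ∏ B : P, ∏ U ∈ p B, φ U := by
  rw [glue, Finset.prod_biUnion]
  intro B _ C _ hBC
  refine Finset.disjoint_left.2 fun U hU hU' => hBC ?_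
  obtain ⟨x, hx⟩ := ((hp B).1 U hU).1
  exact Subtype.ext (hP.eq_of_mem B.2 C.2 (((hp B).1 U hU).2 hx) (((hp C).1 U hU').2 hx))

-- Choosing a non-crossing partition of each block of `P` amounts to choosing a refinement `Q` of
-- `P`, and the blockwise complements glue to `relKr P Q`.
open Classical in
theorem prod_conv {V : Finset α} {P : Finset (Finset α)} (hP : IsNCPartition V P)
    (φ ψ : Finset α → R) :
    ∏ B ∈ P, conv φ ψ B = ∑ Q ∈ (ncPartitions V).filter (Refines · P),
      (∏ U ∈ Q, φ U) * ∏ U ∈ relKr P Q, ψ U := by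
  have hpi : ∀ p : P → Finset (Finset α),
      p ∈ Fintype.piFinset (fun B : P => ncPartitions (B : Finset α)) ↔
        ∀ B : P, IsNCPartition (B : Finset α) (p B) := by
    simp [Fintype.mem_piFinset, mem_ncPartitions]
  rw [← Finset.prod_coe_sort]
  simp only [conv]
  rw [Finset.prod_univ_sum]
  refine Finset.sum_bij' (fun p _ => glue P p) (fun Q _ B => blocksIn Q B) ?_ ?_ ?_ ?_ ?_
  · intro p hp
    rw [hpi] at hp
    exact Finset.mem_filter.2 ⟨mem_ncPartitions.2 (hP.glue hp), refines_glue hp⟩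
  · intro Q hQ
    rw [Finset.mem_filter, mem_ncPartitions] at hQ
    exact (hpi _).2 fun B => hP.blocksIn hQ.1 hQ.2 B.2
  · intro p hp
    rw [hpi] at hp
    exact funext fun B => blocksIn_glue hP hp B
  · intro Q hQ
    exact glue_blocksIn (Finset.mem_filter.1 hQ).2
  · intro p hp
    rw [hpi] at hp
    rw [Finset.prod_mul_distrib, prod_glue hP hp, relKr,
      prod_glue hP (fun _ => isNCPartition_kr _ _)]
    simp only [blocksIn_glue hP hp]

theorem conv_assoc (φ ψ χ : Finset α → R) (V : Finset α) :
    conv (conv φ ψ) χ V = conv φ (conv ψ χ) V := by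
  classical
  have hl : conv (conv φ ψ) χ V = ∑ P ∈ ncPartitions V,
      ∑ Q ∈ (ncPartitions V).filter (Refines · P),
        (∏ U ∈ Q, φ U) * (∏ U ∈ relKr P Q, ψ U) * ∏ U ∈ kr V P, χ U := by
    rw [conv]
    refine Finset.sum_congr rfl fun P hP => ?_
    rw [prod_conv (mem_ncPartitions.1 hP), Finset.sum_mul]
  have hr : conv φ (conv ψ χ) V = ∑ Q ∈ ncPartitions V,
      ∑ R ∈ (ncPartitions V).filter (Refines · (kr V Q)),
        (∏ U ∈ Q, φ U) * ((∏ U ∈ R, ψ U) * ∏ U ∈ relKr (kr V Q) R, χ U) := by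
    rw [conv]
    refine Finset.sum_congr rfl fun Q _ => ?_
    rw [prod_conv (isNCPartition_kr V Q), Finset.mul_sum]
  -- With `Q` summed outermost on both sides, `P ↦ relKr P Q` matches the inner sums.
  rw [hl, hr, Finset.sum_comm' (t' := ncPartitions V)
    (s' := fun Q => (ncPartitions V).filter (Refines Q))
    (by simp only [Finset.mem_filter]; tauto)]
  refine Finset.sum_congr rfl fun Q hQ => ?_
  rw [mem_ncPartitions] at hQ
  refine Finset.sum_bij (fun P _ => relKr P Q) ?_ ?_ ?_ ?_
  · intro P hP
    rw [Finset.mem_filter, mem_ncPartitions] at hP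
    exact Finset.mem_filter.2 ⟨mem_ncPartitions.2 (isNCPartition_relKr hP.1 Q),
      relKr_refines_kr hP.1 hQ hP.2⟩
  · intro P hP P' hP' h
    rw [Finset.mem_filter, mem_ncPartitions] at hP hP'
    refine kr_injOn V hP.1 hP'.1 ?_
    rw [← relKr_kr_relKr hP.1 hQ hP.2, h, relKr_kr_relKr hP'.1 hQ hP'.2]
  · intro R hR
    rw [Finset.mem_filter, mem_ncPartitions] at hR
    obtain ⟨P, hP, hQP, h⟩ := exists_relKr_eq hQ hR.1 hR.2
    exact ⟨P, Finset.mem_filter.2 ⟨mem_ncPartitions.2 hP, hQP⟩, h⟩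
  · intro P hP
    rw [Finset.mem_filter, mem_ncPartitions] at hP
    rw [relKr_kr_relKr hP.1 hQ hP.2, mul_assoc]

/-! ### Transport along monotone and antitone embeddings -/

theorem isNCPartition_mapBlocks {e : α ↪ β} (he : StrictMono e ∨ StrictAnti e) {V : Finset α}
    {P : Finset (Finset α)} : IsNCPartition (V.map e) (mapBlocks e P) ↔ IsNCPartition V P := by
  simp only [IsNCPartition, mem_mapBlocks, Finset.forall_mem_map, exists_exists_and_eq_and,
    forall_exists_index, and_imp, forall_apply_eq_imp_iff₂, Finset.map_nonempty,
    Finset.map_subset_map, Finset.mem_map', Finset.map_inj]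
  refine and_congr_right fun _ => and_congr_right fun _ => and_congr_right fun h => ?_
  rcases he with he | he
  · simp only [he.lt_iff_lt]
  · simp only [he.lt_iff_gt]
    constructor
    · intro H U hU W hW p₁ hp₁ q₁ hq₁ p₂ hp₂ q₂ hq₂ h₁ h₂ h₃
      exact (H W hW U hU q₂ hq₂ p₂ hp₂ q₁ hq₁ p₁ hp₁ h₃ h₂ h₁).symm
    · intro H U hU W hW p₁ hp₁ q₁ hq₁ p₂ hp₂ q₂ hq₂ h₁ h₂ h₃
      exact (H W hW U hU q₂ hq₂ p₂ hp₂ q₁ hq₁ p₁ hp₁ h₃ h₂ h₁).symm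

theorem ncPartitions_map {e : α ↪ β} (he : StrictMono e ∨ StrictAnti e) (V : Finset α) :
    ncPartitions (V.map e) =
      (ncPartitions V).map ⟨mapBlocks e, mapBlocks_injective e⟩ := by
  classical
  ext Q
  simp only [mem_ncPartitions, Finset.mem_map, Function.Embedding.coeFn_mk]
  constructor
  · intro hQ
    have : mapBlocks e (V.powerset.filter fun U => U.map e ∈ Q) = Q := by
      ext W
      simp only [mem_mapBlocks, Finset.mem_filter, Finset.mem_powerset]
      constructor
      · rintro ⟨U, ⟨-, hU⟩, rfl⟩
        exact hU
      · intro hW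
        obtain ⟨U, hUV, rfl⟩ := Finset.subset_map_iff.1 (hQ.1 W hW).2
        exact ⟨U, ⟨hUV, hW⟩, rfl⟩
    exact ⟨_, (isNCPartition_mapBlocks he).1 (this.symm ▸ hQ), this⟩
  · rintro ⟨P, hP, rfl⟩
    exact (isNCPartition_mapBlocks he).2 hP

theorem kr_mapBlocks_of_strictMono {e : α ↪ β} (he : StrictMono e) (V : Finset α)
    (P : Finset (Finset α)) : kr (V.map e) (mapBlocks e P) = mapBlocks e (kr V P) := by
  have h' := (isNCPartition_mapBlocks (Or.inl he)).2 (isNCPartition_kr V P)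
  refine (isNCPartition_kr _ _).ext h' fun x y => ?_
  by_cases hxy : x ∈ V.map e ∧ y ∈ V.map e
  · obtain ⟨hx, hy⟩ := hxy
    obtain ⟨i, hi, rfl⟩ := Finset.mem_map.1 hx
    obtain ⟨j, hj, rfl⟩ := Finset.mem_map.1 hy
    rw [sameBlock_mapBlocks, sameBlock_kr, sameBlock_kr, forall_sameBlock_mapBlocks]
    simp only [he.le_iff_le, Finset.mem_map']
  · exact ⟨fun h => absurd ⟨(isNCPartition_kr _ _).mem_left h, (isNCPartition_kr _ _).mem_right h⟩
      hxy, fun h => absurd ⟨h'.mem_left h, h'.mem_right h⟩ hxy⟩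

theorem kr_mapBlocks_of_strictAnti {e : α ↪ β} (he : StrictAnti e) (V : Finset α)
    (P : Finset (Finset α)) : kr (V.map e) (mapBlocks e P) = mapBlocks e (krInv V P) := by
  have h' := (isNCPartition_mapBlocks (Or.inr he)).2 (isNCPartition_krInv V P)
  refine (isNCPartition_kr _ _).ext h' fun x y => ?_
  by_cases hxy : x ∈ V.map e ∧ y ∈ V.map e
  · obtain ⟨hx, hy⟩ := hxy
    obtain ⟨i, hi, rfl⟩ := Finset.mem_map.1 hx
    obtain ⟨j, hj, rfl⟩ := Finset.mem_map.1 hy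
    rw [sameBlock_mapBlocks, sameBlock_kr, sameBlock_krInv, forall_sameBlock_mapBlocks]
    simp only [he.le_iff_ge, Finset.mem_map']
  · exact ⟨fun h => absurd ⟨(isNCPartition_kr _ _).mem_left h, (isNCPartition_kr _ _).mem_right h⟩
      hxy, fun h => absurd ⟨h'.mem_left h, h'.mem_right h⟩ hxy⟩

theorem conv_map_of_strictMono {e : α ↪ β} (he : StrictMono e) (φ ψ : Finset β → R)
    (V : Finset α) :
    conv φ ψ (V.map e) = conv (fun U => φ (U.map e)) (fun U => ψ (U.map e)) V := by
  rw [conv, ncPartitions_map (Or.inl he), Finset.sum_map]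
  simp only [Function.Embedding.coeFn_mk, kr_mapBlocks_of_strictMono he, prod_mapBlocks, conv]

/-- Reversing the order exchanges the factors of the boxed convolution. -/
theorem conv_map_of_strictAnti {e : α ↪ β} (he : StrictAnti e) (φ ψ : Finset β → R)
    (V : Finset α) :
    conv φ ψ (V.map e) = conv (fun U => ψ (U.map e)) (fun U => φ (U.map e)) V := by
  rw [conv, ncPartitions_map (Or.inr he), Finset.sum_map]
  simp only [Function.Embedding.coeFn_mk, kr_mapBlocks_of_strictAnti he, prod_mapBlocks, conv]
  -- Reindexing by `krInv V P` makes the old partition the complement of the new one.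
  refine Finset.sum_bij' (fun P _ => krInv V P) (fun P _ => kr V P)
    (fun P _ => mem_ncPartitions.2 (isNCPartition_krInv V P))
    (fun P _ => mem_ncPartitions.2 (isNCPartition_kr V P))
    (fun P hP => kr_krInv (mem_ncPartitions.1 hP))
    (fun P hP => krInv_kr (mem_ncPartitions.1 hP)) fun P hP => ?_
  rw [kr_krInv (mem_ncPartitions.1 hP), mul_comm]

/-! ### The unit -/

/-- The partition into singletons. -/
def singletonBlocks (V : Finset α) : Finset (Finset α) := V.image fun x => {x}

theorem isNCPartition_singletonBlocks (V : Finset α) :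
    IsNCPartition V (singletonBlocks V) := by
  simp only [IsNCPartition, singletonBlocks, Finset.mem_image, forall_exists_index, and_imp,
    forall_apply_eq_imp_iff₂, exists_exists_and_eq_and, Finset.mem_singleton]
  refine ⟨by simp, fun x hx => ⟨x, hx, rfl⟩, ?_, ?_⟩ <;> grind

theorem isNCPartition_singleton {V : Finset α} (hV : V.Nonempty) : IsNCPartition V {V} := by
  simp [IsNCPartition, hV]

theorem kr_singletonBlocks {V : Finset α} (hV : V.Nonempty) :
    kr V (singletonBlocks V) = {V} := by
  refine (isNCPartition_kr _ _).ext (isNCPartition_singleton hV) fun x y => ?_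
  rw [sameBlock_kr]
  simp only [SameBlock, singletonBlocks, Finset.mem_image, exists_exists_and_eq_and,
    Finset.mem_singleton, exists_eq_left]
  grind

theorem kr_singleton {V : Finset α} (hV : V.Nonempty) :
    kr V {V} = singletonBlocks V := by
  refine (isNCPartition_kr _ _).ext (isNCPartition_singletonBlocks V) fun x y => ?_
  rw [sameBlock_kr]
  simp only [SameBlock, singletonBlocks, Finset.mem_image, exists_exists_and_eq_and,
    Finset.mem_singleton, exists_eq_left]
  constructor
  · rintro ⟨hx, hy, h⟩
    -- The minimum lies below both `x` and `y`, so comparing it with `x` and with `y` inside the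
    -- only block forces `x ≤ y` and `y ≤ x`.
    obtain ⟨m, hm, hmin⟩ := V.exists_min_image id hV
    have h1 := h x m ⟨hx, hm⟩
    have h2 := h y m ⟨hy, hm⟩
    have h3 := hmin x hx
    have h4 := hmin y hy
    simp only [id] at h3 h4
    exact ⟨x, hx, rfl, by grind⟩
  · rintro ⟨z, hz, rfl, rfl⟩
    simp [hz]

theorem eq_singletonBlocks {V : Finset α} {P : Finset (Finset α)} (hP : IsNCPartition V P)
    (h : ∀ U ∈ P, U.card = 1) : P = singletonBlocks V := by
  refine hP.ext (isNCPartition_singletonBlocks V) fun x y => ?_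
  simp only [SameBlock, singletonBlocks, Finset.mem_image, exists_exists_and_eq_and,
    Finset.mem_singleton]
  constructor
  · rintro ⟨U, hU, hx, hy⟩
    exact ⟨x, (hP.1 U hU).2 hx, rfl, Finset.card_le_one.1 (h U hU).le y hy x hx⟩
  · rintro ⟨z, hz, rfl, rfl⟩
    exact hP.refl hz

theorem conv_one_left (ψ : Finset α → R) {V : Finset α} (hV : V.Nonempty) :
    conv (fun U => if U.card = 1 then 1 else 0) ψ V = ψ V := by
  rw [conv, Finset.sum_eq_single (singletonBlocks V)]
  · rw [kr_singletonBlocks hV, Finset.prod_singleton, Finset.prod_eq_one, one_mul]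
    simp [singletonBlocks]
  · intro P hP hne
    have : ∃ U ∈ P, U.card ≠ 1 := by
      by_contra! h
      exact hne (eq_singletonBlocks (mem_ncPartitions.1 hP) h)
    obtain ⟨U, hU, hc⟩ := this
    rw [Finset.prod_eq_zero hU (by simp [hc]), zero_mul]
  · exact fun h => absurd (mem_ncPartitions.2 (isNCPartition_singletonBlocks V)) h

/-- Passing to the order dual exchanges the factors and reduces this to `conv_one_left`. -/
theorem conv_one_right (φ : Finset α → R) {V : Finset α} (hV : V.Nonempty) :
    conv φ (fun U => if U.card = 1 then 1 else 0) V = φ V := by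
  have he : StrictAnti (OrderDual.ofDual (α := α)).toEmbedding := fun _ _ h => h
  obtain ⟨W, rfl⟩ : ∃ W : Finset αᵒᵈ, V = W.map (OrderDual.ofDual (α := α)).toEmbedding :=
    ⟨V.map (OrderDual.toDual (α := α)).toEmbedding, by ext; simp⟩
  rw [conv_map_of_strictAnti he]
  simp only [Finset.card_map]
  exact conv_one_left _ (Finset.map_nonempty.1 hV)

/-- `Fin.rev` exchanges the factors and preserves cardinalities. -/
theorem conv_comm_of_card {n : ℕ} (φ ψ : ℕ → R) :
    conv (fun U : Finset (Fin n) => φ U.card) (fun U => ψ U.card) Finset.univ =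
      conv (fun U : Finset (Fin n) => ψ U.card) (fun U => φ U.card) Finset.univ := by
  have hu : (Finset.univ : Finset (Fin n)) =
      (Finset.univ : Finset (Fin n)).map (Fin.revPerm (n := n)).toEmbedding :=
    (Finset.map_univ_equiv _).symm
  conv_lhs => rw [hu]
  rw [conv_map_of_strictAnti (e := Fin.revPerm.toEmbedding) fun i j h => Fin.rev_lt_rev.2 h]
  simp only [Finset.card_map]

end Convolution

/-! ### Identification of the boxed convolution of series with `conv`. -/

section Bridge

theorem isNCPartition_parts {n : ℕ} (π : NC n) : IsNCPartition Finset.univ π.1.parts := by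
  refine ⟨fun U hU => ⟨π.1.nonempty_of_mem_parts hU, Finset.subset_univ U⟩,
    fun x hx => ?_, fun U hU W hW x hx hx' => π.1.eq_of_mem_parts hU hW hx hx',
    fun U hU W hW p₁ hp₁ q₁ hq₁ p₂ hp₂ q₂ hq₂ h₁ h₂ h₃ =>
      π.2 U hU W hW p₁ q₁ p₂ q₂ h₁ h₂ h₃ hp₁ hp₂ hq₁ hq₂⟩
  exact ⟨π.1.part x, π.1.part_mem.2 hx, π.1.mem_part hx⟩

theorem exists_parts_eq {n : ℕ} {P : Finset (Finset (Fin n))}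
    (hP : IsNCPartition Finset.univ P) : ∃ π : NC n, π.1.parts = P := by
  refine ⟨⟨Finpartition.ofExistsUnique P (fun U _ => Finset.subset_univ U) (fun x hx => ?_)
    fun h => by simpa using (hP.1 ∅ h).1, ?_⟩, rfl⟩
  · obtain ⟨U, hU, hxU⟩ := hP.2.1 x hx
    exact ⟨U, ⟨hU, hxU⟩, fun W hW => hP.eq_of_mem hW.1 hU hW.2 hxU⟩
  · exact fun U hU W hW p₁ q₁ p₂ q₂ h₁ h₂ h₃ hp₁ hp₂ hq₁ hq₂ =>
      hP.2.2.2 U hU W hW p₁ hp₁ q₁ hq₁ p₂ hp₂ q₂ hq₂ h₁ h₂ h₃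

/-- Since `i'` comes immediately after `i`, the unprimed points between `i'` and `j'` are those of
`(i, j]`; this is the source of the half-open intervals. -/
theorem isNonCrossing_interleave_iff {n : ℕ} (π σ : NC n) :
    IsNonCrossing (interleave π.1 σ.1) ↔
      ∀ i j, SameBlock σ.1.parts i j → CutRight π.1.parts i j := by
  have hb₁ : (false < true) = True := by decide
  have hb₂ : (true < false) = False := by decide
  constructor
  · intro hσ
    have key : ∀ W ∈ σ.1.parts, ∀ i ∈ W, ∀ j ∈ W, i < j → CutRight π.1.parts i j := by
      intro W hW i hi j hj hij V hV
      have hVm : (V.image fun i => toLex (i, false)) ∈ interleave π.1 σ.1 :=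
        Finset.mem_union_left _ (Finset.mem_image_of_mem _ hV)
      have hWm : (W.image fun i => toLex (i, true)) ∈ interleave π.1 σ.1 :=
        Finset.mem_union_right _ (Finset.mem_image_of_mem _ hW)
      have ht : ∀ x ∈ W, (toLex (x, true) : Fin n ×ₗ Bool) ∈ W.image fun i => toLex (i, true) :=
        fun x hx => Finset.mem_image_of_mem _ hx
      have hf : ∀ x ∈ V, (toLex (x, false) : Fin n ×ₗ Bool) ∈
          V.image fun i => toLex (i, false) := fun x hx => Finset.mem_image_of_mem _ hx
      have hne : (V.image fun i => (toLex (i, false) : Fin n ×ₗ Bool)) ≠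
          W.image fun i => toLex (i, true) := by
        intro h
        have := ht i hi
        rw [← h] at this
        simp at this
      have main : ∀ a ∈ V, ∀ b ∈ V, i < a → a ≤ j → ¬ (b ≤ i) ∧ b ≤ j := by
        intro a ha b hb hia haj
        constructor
        · intro hbi
          refine hne (hσ _ hVm _ hWm _ _ _ _ ?_ ?_ ?_ (hf b hb) (hf a ha) (ht i hi) (ht j hj)) <;>
            simp [Prod.Lex.toLex_lt_toLex, ← le_iff_lt_or_eq, *]
        · by_contra hbj
          rw [not_le] at hbj
          refine hne (hσ _ hWm _ hVm _ _ _ _ ?_ ?_ ?_ (ht i hi) (ht j hj)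
            (hf a ha) (hf b hb)).symm <;>
            simp [Prod.Lex.toLex_lt_toLex, ← le_iff_lt_or_eq, *]
      intro a ha b hb
      have h1 := main a ha b hb
      have h2 := main b hb a ha
      grind
    rintro i j ⟨W, hW, hi, hj⟩
    rcases lt_trichotomy i j with h | rfl | h
    · exact key W hW i hi j hj h
    · exact (cutRight_equivalence _).refl _
    · exact (cutRight_equivalence _).symm (key W hW j hj i hi h)
  · intro h V hV W hW p₁ q₁ p₂ q₂ h₁ h₂ h₃ hp₁ hp₂ hq₁ hq₂
    simp only [interleave, Finset.mem_union, Finset.mem_image] at hV hW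
    rcases hV with ⟨V, hV, rfl⟩ | ⟨V, hV, rfl⟩ <;> rcases hW with ⟨W, hW, rfl⟩ | ⟨W, hW, rfl⟩ <;>
      simp only [Finset.mem_image] at hp₁ hp₂ hq₁ hq₂ <;>
      obtain ⟨p₁, hp₁, rfl⟩ := hp₁ <;> obtain ⟨p₂, hp₂, rfl⟩ := hp₂ <;>
      obtain ⟨q₁, hq₁, rfl⟩ := hq₁ <;> obtain ⟨q₂, hq₂, rfl⟩ := hq₂ <;>
      simp [Prod.Lex.toLex_lt_toLex, hb₁, hb₂, ← le_iff_lt_or_eq] at h₁ h₂ h₃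
    · rw [π.2 V hV W hW p₁ q₁ p₂ q₂ h₁ h₂ h₃ hp₁ hp₂ hq₁ hq₂]
    · have := h q₁ q₂ ⟨W, hW, hq₁, hq₂⟩ V hV p₁ hp₁ p₂ hp₂
      exfalso
      clear h
      grind
    · have := h p₁ p₂ ⟨V, hV, hp₁, hp₂⟩ W hW q₁ hq₁ q₂ hq₂
      exfalso
      clear h
      grind
    · rw [σ.2 V hV W hW p₁ q₁ p₂ q₂ h₁ h₂ h₃ hp₁ hp₂ hq₁ hq₂]

/-- By `isNonCrossing_interleave_iff` the admissible `σ` are those refining `kr`, which is itself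
admissible. -/
theorem parts_kreweras {n : ℕ} (π : NC n) :
    (kreweras π).1.parts = kr Finset.univ π.1.parts := by
  obtain ⟨hmem, hub⟩ := kreweras_isGreatest π
  obtain ⟨σ, hσ⟩ := exists_parts_eq (isNCPartition_kr Finset.univ π.1.parts)
  have hle : σ ≤ kreweras π := by
    refine hub ((isNonCrossing_interleave_iff π σ).2 fun i j hij => ?_)
    rw [hσ, sameBlock_kr] at hij
    exact cutRight_iff.2 hij.2.2
  refine (isNCPartition_parts _).ext (isNCPartition_kr _ _) fun i j => ⟨fun h => ?_, fun h => ?_⟩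
  · exact sameBlock_kr.2 ⟨Finset.mem_univ i, Finset.mem_univ j,
      cutRight_iff.1 ((isNonCrossing_interleave_iff π _).1 hmem i j h)⟩
  · rw [← hσ] at h
    obtain ⟨U, hU, hi, hj⟩ := h
    obtain ⟨W, hW, hUW⟩ := hle hU
    exact ⟨W, hW, hUW hi, hUW hj⟩

variable {α β : Type*} [LinearOrder α] [LinearOrder β] {s : ℕ} {R : Type*} [CommRing R]

/-- The restriction of the word `w` to the set `V` of positions in a linear order. -/
def wordOn (w : α → Fin s) (V : Finset α) : Word s := (V.sort (· ≤ ·)).map w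

theorem length_wordOn (w : α → Fin s) (V : Finset α) : (wordOn w V).length = V.card := by
  simp [wordOn]

theorem wordOn_map {e : α ↪ β} (he : StrictMono e) (w : β → Fin s) (V : Finset α) :
    wordOn w (V.map e) = wordOn (w ∘ e) V := by
  rw [wordOn, wordOn, ← List.map_map, (he.strictMonoOn _).map_finsetSort]

/-- The coefficient of `f` at the restriction of the word `w` to `V`. -/
def MSeries.coeffOn (f : MSeries s R) (w : α → Fin s) (V : Finset α) : R := f.coeff (wordOn w V)

theorem box_coeff_eq_conv (f g : MSeries s R) {w : Word s} (hw : w ≠ []) :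
    (f ⊠ g).coeff w = conv (f.coeffOn w.get) (g.coeffOn w.get) Finset.univ := by
  simp only [MSeries.box, if_neg hw]
  refine Finset.sum_bij (fun π _ => π.1.parts)
    (fun π _ => mem_ncPartitions.2 (isNCPartition_parts π)) (fun π _ σ _ h => ?_)
    (fun P hP => ?_) fun π _ => ?_
  · exact Subtype.ext (Finpartition.ext h)
  · obtain ⟨π, h⟩ := exists_parts_eq (mem_ncPartitions.1 hP)
    exact ⟨π, Finset.mem_univ _, h⟩
  · rw [MSeries.partCoeff, MSeries.partCoeff, parts_kreweras]
    rfl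

/-- Needed to iterate convolutions: the increasing enumeration of `V` carries the convolution over
positions of the subword to `V`. The empty set is excluded because `conv` is `1` there, while a
series has constant term `0`. -/
theorem box_coeffOn (f g : MSeries s R) (w : α → Fin s) {V : Finset α} (hV : V.Nonempty) :
    (f ⊠ g).coeffOn w V = conv (f.coeffOn w) (g.coeffOn w) V := by
  have hl := length_wordOn w V
  have hne : wordOn w V ≠ [] := by
    rw [← List.length_pos_iff, hl]
    exact hV.card_pos
  let e : Fin (wordOn w V).length ↪o α := V.orderEmbOfFin hl.symm
  have hV' : V = Finset.univ.map e.toEmbedding := (Finset.map_orderEmbOfFin_univ _ _).symm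
  have hget : (wordOn w V).get = w ∘ e := by
    funext i
    simp only [e, Function.comp_apply, Finset.orderEmbOfFin_apply]
    exact List.getElem_map w
  rw [MSeries.coeffOn, box_coeff_eq_conv f g hne, hget]
  conv_rhs => rw [hV']
  rw [conv_map_of_strictMono e.strictMono]
  simp only [MSeries.coeffOn, wordOn_map (e := e.toEmbedding) e.strictMono]
  rfl

end Bridge

/-! ### Monoid laws for series. -/

section Monoid

theorem conv_congr {α R : Type*} [LinearOrder α] [CommRing R] {φ φ' ψ ψ' : Finset α → R}
    (hφ : ∀ U : Finset α, U.Nonempty → φ U = φ' U) (hψ : ∀ U : Finset α, U.Nonempty → ψ U = ψ' U)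
    (V : Finset α) : conv φ ψ V = conv φ' ψ' V := by
  refine Finset.sum_congr rfl fun P hP => ?_
  congr 1
  · exact Finset.prod_congr rfl fun U hU => hφ U ((mem_ncPartitions.1 hP).1 U hU).1
  · exact Finset.prod_congr rfl fun U hU => hψ U ((isNCPartition_kr V P).1 U hU).1

namespace MSeries

variable {s : ℕ} {R : Type*} [CommRing R]

theorem wordOn_get_univ (w : Word s) : wordOn w.get Finset.univ = w := by
  rw [wordOn, Fin.sort_univ, List.map_get_finRange]

theorem coeffOn_get_univ (f : MSeries s R) (w : Word s) :
    f.coeffOn w.get Finset.univ = f.coeff w := by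
  rw [coeffOn, wordOn_get_univ]

theorem ext_of_ne_nil {f g : MSeries s R} (h : ∀ w ≠ [], f.coeff w = g.coeff w) : f = g := by
  ext w
  by_cases hw : w = []
  · rw [hw, f.coeff_nil, g.coeff_nil]
  · exact h w hw

theorem univ_nonempty {w : Word s} (hw : w ≠ []) :
    (Finset.univ : Finset (Fin w.length)).Nonempty :=
  ⟨⟨0, List.length_pos_iff.2 hw⟩, Finset.mem_univ _⟩

theorem box_assoc (f g h : MSeries s R) : f ⊠ g ⊠ h = f ⊠ (g ⊠ h) := by
  refine ext_of_ne_nil fun w hw => ?_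
  rw [box_coeff_eq_conv _ _ hw, box_coeff_eq_conv _ _ hw,
    conv_congr (fun U hU => box_coeffOn f g w.get hU) (fun _ _ => rfl), conv_assoc]
  exact conv_congr (fun _ _ => rfl) (fun U hU => (box_coeffOn g h w.get hU).symm) _

theorem boxOne_coeff (w : Word s) : (boxOne s R).coeff w = if w.length = 1 then 1 else 0 := by
  simp only [boxOne, z]
  split_ifs with h
  · obtain ⟨i, rfl⟩ := List.length_eq_one_iff.1 h
    simp
  · refine Finset.sum_eq_zero fun i _ => if_neg ?_
    rintro rfl
    exact h rfl

theorem boxOne_coeffOn {α : Type*} [LinearOrder α] (w : α → Fin s) :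
    (boxOne s R).coeffOn w = fun V => if V.card = 1 then 1 else 0 := by
  funext V
  rw [coeffOn, boxOne_coeff, length_wordOn]

theorem boxOne_box (f : MSeries s R) : boxOne s R ⊠ f = f := by
  refine ext_of_ne_nil fun w hw => ?_
  rw [box_coeff_eq_conv _ _ hw, boxOne_coeffOn, conv_one_left _ (univ_nonempty hw),
    coeffOn_get_univ]

theorem box_boxOne (f : MSeries s R) : f ⊠ boxOne s R = f := by
  refine ext_of_ne_nil fun w hw => ?_
  rw [box_coeff_eq_conv _ _ hw, boxOne_coeffOn, conv_one_right _ (univ_nonempty hw),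
    coeffOn_get_univ]

theorem box_comm (f g : MSeries 1 R) : f ⊠ g = g ⊠ f := by
  refine ext_of_ne_nil fun w hw => ?_
  have key : ∀ f : MSeries 1 R,
      f.coeffOn w.get = fun U => f.coeff (List.replicate U.card 0) := by
    intro f
    funext U
    rw [coeffOn]
    congr 1
    exact List.eq_replicate_iff.2 ⟨length_wordOn _ _, fun _ _ => Subsingleton.elim _ _⟩
  rw [box_coeff_eq_conv _ _ hw, box_coeff_eq_conv _ _ hw, key f, key g]
  exact conv_comm_of_card (fun n => f.coeff (List.replicate n 0))
    fun n => g.coeff (List.replicate n 0)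

/-! ### Inverses -/

/-- The coefficients of the left inverse of `f`, by recursion on the length of the word. -/
noncomputable def leftInvCoeff (f : MSeries s R) (w : Word s) : R :=
  if w = [] then 0 else
    -- The equation at `w` is solved for the term of `{Finset.univ}`, whose complement consists of
    -- singletons. `Ring.inverse` is `0` at non-units, which keeps the definition total.
    Ring.inverse (∏ i, f.coeff [w.get i]) * ((boxOne s R).coeff w -
      ∑ P ∈ (ncPartitions (Finset.univ : Finset (Fin w.length))).erase {Finset.univ},
        -- The test serves the recursion only: it always succeeds, as a partition other than
        -- `{Finset.univ}` has only proper blocks.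
        (∏ U ∈ P, if _ : (wordOn w.get U).length < w.length
          then leftInvCoeff f (wordOn w.get U) else 0) *
          ∏ U ∈ kr Finset.univ P, f.coeffOn w.get U)
termination_by w.length

/-- The left inverse of `f` for the boxed convolution. -/
noncomputable def leftInv (f : MSeries s R) : MSeries s R where
  coeff := leftInvCoeff f
  coeff_nil := by rw [leftInvCoeff, if_pos rfl]

theorem leftInv_box {f : MSeries s R} (hf : f ∈ unitSeries s R) :
    f.leftInv ⊠ f = boxOne s R := by
  refine ext_of_ne_nil fun w hw => ?_
  have hne := univ_nonempty hw
  rw [box_coeff_eq_conv _ _ hw, conv, ← Finset.add_sum_erase _ _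
    (mem_ncPartitions.2 (isNCPartition_singleton hne)), Finset.prod_singleton,
    kr_singleton hne, coeffOn_get_univ]
  have hprod : ∏ U ∈ singletonBlocks (Finset.univ : Finset (Fin w.length)), f.coeffOn w.get U =
      ∏ i, f.coeff [w.get i] := by
    rw [singletonBlocks, Finset.prod_image fun i _ j _ h => Finset.singleton_injective h]
    simp [coeffOn, wordOn]
  have hunit : IsUnit (∏ i, f.coeff [w.get i]) :=
    IsUnit.prod_univ_iff.2 fun i => hf (w.get i)
  have hsum : ∀ P ∈ (ncPartitions (Finset.univ : Finset (Fin w.length))).erase {Finset.univ},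
      ∏ U ∈ P, f.leftInv.coeffOn w.get U =
        ∏ U ∈ P, if _ : (wordOn w.get U).length < w.length
          then leftInvCoeff f (wordOn w.get U) else 0 := by
    intro P hP
    rw [Finset.mem_erase, mem_ncPartitions] at hP
    refine Finset.prod_congr rfl fun U hU => ?_
    rw [dif_pos]
    · rfl
    · rw [length_wordOn]
      refine lt_of_le_of_ne (by simpa using Finset.card_le_univ U) fun h => hP.1 ?_
      have hUu : U = Finset.univ := by
        rw [← Finset.card_eq_iff_eq_univ, h, Fintype.card_fin]
      subst hUu
      refine Finset.eq_singleton_iff_unique_mem.2 ⟨hU, fun W hW => ?_⟩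
      obtain ⟨x, hx⟩ := (hP.2.1 W hW).1
      exact hP.2.eq_of_mem hW hU hx (Finset.mem_univ x)
  rw [hprod, Finset.sum_congr rfl fun P hP => by rw [hsum P hP]]
  have hw' : f.leftInv.coeff w = leftInvCoeff f w := rfl
  rw [hw', leftInvCoeff, if_neg hw, mul_right_comm, Ring.inverse_mul_cancel _ hunit, one_mul,
    sub_add_cancel]

/-! ### Coefficients of low degree -/

theorem sort_eq_of_toFinset_eq {α : Type*} [LinearOrder α] {l : List α} {V : Finset α}
    (h : l.toFinset = V) (hl : l.Pairwise (· < ·)) : V.sort (· ≤ ·) = l := by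
  subst h
  exact (List.toFinset_sort _ (hl.imp fun h => h.ne)).2 (hl.imp fun h => h.le)

theorem box_coeff_one (f g : MSeries s R) (i : Fin s) :
    (f ⊠ g).coeff [i] = f.coeff [i] * g.coeff [i] := by
  have h := box_coeffOn f g ![i] (V := Finset.univ) ⟨0, Finset.mem_univ 0⟩
  have h1 : ncPartitions (Finset.univ : Finset (Fin 1)) = {{{0}}} := by decide
  have h2 : kr (Finset.univ : Finset (Fin 1)) {{0}} = {{0}} := by decide
  rw [conv, h1, Finset.sum_singleton, h2] at h
  simpa [coeffOn, wordOn, Fin.sort_univ] using h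

theorem box_coeff_two (f g : MSeries s R) (i j : Fin s) :
    (f ⊠ g).coeff [i, j] = f.coeff [i, j] * (g.coeff [i] * g.coeff [j]) +
      f.coeff [i] * f.coeff [j] * g.coeff [i, j] := by
  have h := box_coeffOn f g ![i, j] (V := Finset.univ) ⟨0, Finset.mem_univ 0⟩
  have h1 : ncPartitions (Finset.univ : Finset (Fin 2)) = {{{0, 1}}, {{0}, {1}}} := by decide
  have h2 : kr (Finset.univ : Finset (Fin 2)) {{0, 1}} = {{0}, {1}} := by decide
  have h3 : kr (Finset.univ : Finset (Fin 2)) {{0}, {1}} = {{0, 1}} := by decide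
  have e : ({0, 1} : Finset (Fin 2)).sort (· ≤ ·) = [0, 1] :=
    sort_eq_of_toFinset_eq (by decide) (by decide)
  rw [conv, h1, Finset.sum_pair (by decide), h2, h3] at h
  rw [Finset.prod_pair (by decide), Finset.prod_pair (by decide)] at h
  simpa [coeffOn, wordOn, Fin.sort_univ, List.finRange, e] using h

theorem box_coeff_three (f g : MSeries s R) (i j k : Fin s) :
    (f ⊠ g).coeff [i, j, k] = f.coeff [i, j, k] * (g.coeff [i] * g.coeff [j] * g.coeff [k]) +
      f.coeff [i, j] * f.coeff [k] * (g.coeff [i] * g.coeff [j, k]) +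
      f.coeff [i, k] * f.coeff [j] * (g.coeff [i, j] * g.coeff [k]) +
      f.coeff [i] * f.coeff [j, k] * (g.coeff [i, k] * g.coeff [j]) +
      f.coeff [i] * f.coeff [j] * f.coeff [k] * g.coeff [i, j, k] := by
  have h := box_coeffOn f g ![i, j, k] (V := Finset.univ) ⟨0, Finset.mem_univ 0⟩
  have h1 : ncPartitions (Finset.univ : Finset (Fin 3)) =
      {{{0, 1, 2}}, {{0, 1}, {2}}, {{0, 2}, {1}}, {{0}, {1, 2}}, {{0}, {1}, {2}}} := by
    decide +kernel
  have k1 : kr (Finset.univ : Finset (Fin 3)) {{0, 1, 2}} = {{0}, {1}, {2}} := by decide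
  have k2 : kr (Finset.univ : Finset (Fin 3)) {{0, 1}, {2}} = {{0}, {1, 2}} := by decide
  have k3 : kr (Finset.univ : Finset (Fin 3)) {{0, 2}, {1}} = {{0, 1}, {2}} := by decide
  have k4 : kr (Finset.univ : Finset (Fin 3)) {{0}, {1, 2}} = {{0, 2}, {1}} := by decide
  have k5 : kr (Finset.univ : Finset (Fin 3)) {{0}, {1}, {2}} = {{0, 1, 2}} := by decide
  have e1 : ({0, 1} : Finset (Fin 3)).sort (· ≤ ·) = [0, 1] :=
    sort_eq_of_toFinset_eq (by decide) (by decide)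
  have e2 : ({0, 2} : Finset (Fin 3)).sort (· ≤ ·) = [0, 2] :=
    sort_eq_of_toFinset_eq (by decide) (by decide)
  have e3 : ({1, 2} : Finset (Fin 3)).sort (· ≤ ·) = [1, 2] :=
    sort_eq_of_toFinset_eq (by decide) (by decide)
  have e4 : ({0, 1, 2} : Finset (Fin 3)).sort (· ≤ ·) = [0, 1, 2] :=
    sort_eq_of_toFinset_eq (by decide) (by decide)
  have e5 : (Finset.univ : Finset (Fin 3)).sort (· ≤ ·) = [0, 1, 2] :=
    sort_eq_of_toFinset_eq (by decide) (by decide)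
  rw [conv, h1, Finset.sum_insert (by decide), Finset.sum_insert (by decide),
    Finset.sum_insert (by decide), Finset.sum_pair (by decide), k1, k2, k3, k4, k5] at h
  have hp : ∀ φ : Finset (Fin 3) → R,
      ∏ U ∈ ({{0}, {1}, {2}} : Finset (Finset (Fin 3))), φ U = φ {0} * φ {1} * φ {2} := by
    intro φ
    rw [Finset.prod_insert (by decide), Finset.prod_pair (by decide), mul_assoc]
  rw [Finset.prod_pair (by decide), Finset.prod_pair (by decide), Finset.prod_pair (by decide),
    Finset.prod_pair (by decide), Finset.prod_pair (by decide), Finset.prod_pair (by decide),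
    hp, hp] at h
  simpa [coeffOn, wordOn, e1, e2, e3, e4, e5, add_assoc] using h

end MSeries

end Monoid

/-! ### Additive laws, counterexamples and the group of series with invertible linear part. -/

namespace MSeries

variable {s : ℕ} {R : Type*} [CommRing R]

theorem add_coeff (f g : MSeries s R) (w : Word s) :
    (f + g).coeff w = f.coeff w + g.coeff w := rfl

/-- The monomial `z_v`, for a nonempty word `v`. -/
def monomial (v : Word s) (hv : v ≠ []) : MSeries s R :=
  ⟨fun w => if w = v then 1 else 0, if_neg hv.symm⟩

theorem monomial_coeff (v : Word s) (hv : v ≠ []) (w : Word s) :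
    (monomial v hv : MSeries s R).coeff w = if w = v then 1 else 0 := rfl

theorem z_coeff (i : Fin s) (w : Word s) :
    (z i : MSeries s R).coeff w = if w = [i] then 1 else 0 := rfl

theorem add_group_laws :
    (∀ f g h : MSeries s R, f + g + h = f + (g + h)) ∧
      (∀ f g : MSeries s R, f + g = g + f) ∧
      (∀ f : MSeries s R, f + 0 = f) ∧
      (∀ f : MSeries s R, ∃ g : MSeries s R, f + g = 0) := by
  refine ⟨fun f g h => ?_, fun f g => ?_, fun f => ?_,
    fun f => ⟨⟨fun w => -f.coeff w, by simp [coeff_nil]⟩, ?_⟩⟩ <;> ext w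
  · exact add_assoc _ _ _
  · exact add_comm _ _
  · exact add_zero _
  · exact add_neg_cancel (f.coeff w)

theorem two_eq_three_absurd [Nontrivial R] (h₂ : (2 : R) = 0) (h₃ : (3 : R) = 0) : False := by
  apply one_ne_zero (α := R)
  linear_combination h₃ - h₂

theorem exists_add_box_ne [Nontrivial R] (i : Fin s) :
    ∃ f f' g : MSeries s R, (f + f') ⊠ g ≠ f ⊠ g + f' ⊠ g := by
  by_contra! h
  -- The first choice has defect `4 - 2 = 2`, the second has defect `3`. Either may vanish in `R`,
  -- but not both.
  have h₂ := congrArg (fun f => f.coeff [i, i]) (h (z i) (z i) (monomial [i, i] (by simp)))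
  have h₃ := congrArg (fun f => f.coeff [i, i, i])
    (h (z i) (monomial [i, i] (by simp)) (z i + monomial [i, i] (by simp)))
  simp [add_coeff, box_coeff_two, box_coeff_three, z_coeff, monomial_coeff] at h₂ h₃
  exact two_eq_three_absurd (R := R) (by linear_combination h₂) (by linear_combination h₃)

theorem exists_box_add_ne [Nontrivial R] (i : Fin s) :
    ∃ f g g' : MSeries s R, f ⊠ (g + g') ≠ f ⊠ g + f ⊠ g' := by
  by_contra! h
  have h₂ := congrArg (fun f => f.coeff [i, i]) (h (monomial [i, i] (by simp)) (z i) (z i))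
  have h₃ := congrArg (fun f => f.coeff [i, i, i])
    (h (z i + monomial [i, i] (by simp)) (z i) (monomial [i, i] (by simp)))
  simp [add_coeff, box_coeff_two, box_coeff_three, z_coeff, monomial_coeff] at h₂ h₃
  exact two_eq_three_absurd (R := R) (by linear_combination h₂) (by linear_combination h₃)

theorem boxOne_mem_unitSeries : boxOne s R ∈ unitSeries s R := fun i => by
  rw [boxOne_coeff]
  exact isUnit_one

theorem box_mem_unitSeries {f g : MSeries s R} (hf : f ∈ unitSeries s R)
    (hg : g ∈ unitSeries s R) : f ⊠ g ∈ unitSeries s R := fun i => by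
  rw [box_coeff_one]
  exact (hf i).mul (hg i)

theorem leftInv_mem_unitSeries {f : MSeries s R} (hf : f ∈ unitSeries s R) :
    f.leftInv ∈ unitSeries s R := fun i => by
  have h := boxOne_mem_unitSeries (R := R) i
  rw [← leftInv_box hf, box_coeff_one] at h
  exact isUnit_of_mul_isUnit_left h

/-- The formula of `box_coeff_two` is symmetric in `f` and `g`, so degree three is the first where
the two products can differ. At `[i, j, i]` only the pairing of `f` at `[i, j]` with `g` at `[j, i]`
survives in `f ⊠ g`, giving `1`, and nothing survives in `g ⊠ f`. -/
theorem exists_unitSeries_box_ne [Nontrivial R] (hs : 2 ≤ s) :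
    ∃ f ∈ unitSeries s R, ∃ g ∈ unitSeries s R, f ⊠ g ≠ g ⊠ f := by
  let i : Fin s := ⟨0, by lia⟩
  let j : Fin s := ⟨1, by lia⟩
  have hij : i ≠ j := by simp [i, j]
  have hmem : ∀ a b : Fin s,
      boxOne s R + monomial [a, b] (by simp) ∈ unitSeries s R := fun a b k => by
    simp [add_coeff, boxOne_coeff, monomial_coeff]
  refine ⟨_, hmem i j, _, hmem j i, fun h => ?_⟩
  have h₃ := congrArg (fun f => f.coeff [i, j, i]) h
  simp [add_coeff, box_coeff_three, boxOne_coeff, monomial_coeff, hij, hij.symm] at h₃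

/-- The group of series with invertible linear coefficients. -/
@[reducible]
noncomputable def unitSeriesGroup (s : ℕ) (R : Type*) [CommRing R] : Group (unitSeries s R) :=
  letI : Mul (unitSeries s R) := ⟨fun f g => ⟨f.1 ⊠ g.1, box_mem_unitSeries f.2 g.2⟩⟩
  letI : One (unitSeries s R) := ⟨⟨boxOne s R, boxOne_mem_unitSeries⟩⟩
  letI : Inv (unitSeries s R) := ⟨fun f => ⟨f.1.leftInv, leftInv_mem_unitSeries f.2⟩⟩
  Group.ofLeftAxioms (fun f g h => Subtype.ext (box_assoc f.1 g.1 h.1))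
    (fun f => Subtype.ext (boxOne_box f.1)) fun f => Subtype.ext (leftInv_box f.2)

end MSeries

theorem mainTheorem7 (s : ℕ) (hs : 1 ≤ s) (R : Type*) [CommRing R] :
    -- addition makes the series without constant term an abelian group with neutral element `0`
    ((∀ f g h : MSeries s R, f + g + h = f + (g + h)) ∧
      (∀ f g : MSeries s R, f + g = g + f) ∧
      (∀ f : MSeries s R, f + 0 = f) ∧
      (∀ f : MSeries s R, ∃ g : MSeries s R, f + g = 0)) ∧
    -- the boxed convolution is associative with unit `z_1 + ⋯ + z_s`
    ((∀ f g h : MSeries s R, f ⊠ g ⊠ h = f ⊠ (g ⊠ h)) ∧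
      (∀ f : MSeries s R, MSeries.boxOne s R ⊠ f = f) ∧
      (∀ f : MSeries s R, f ⊠ MSeries.boxOne s R = f)) ∧
    -- it distributes over addition on neither side
    (Nontrivial R →
      (∃ f f' g : MSeries s R, (f + f') ⊠ g ≠ f ⊠ g + f' ⊠ g) ∧
      (∃ f g g' : MSeries s R, f ⊠ (g + g') ≠ f ⊠ g + f ⊠ g')) ∧
    -- it is commutative for `s = 1` and not commutative for `s ≥ 2`
    (s = 1 → ∀ f g : MSeries s R, f ⊠ g = g ⊠ f) ∧
    (2 ≤ s → Nontrivial R → ∃ f g : MSeries s R, f ⊠ g ≠ g ⊠ f) ∧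
    -- the series with invertible linear coefficients form a group, which is abelian for `s = 1`
    -- and non-abelian for `s ≥ 2`
    ∃ _ : Group (MSeries.unitSeries s R),
      (∀ f g : MSeries.unitSeries s R,
        ((f * g : MSeries.unitSeries s R) : MSeries s R) = (f : MSeries s R) ⊠ (g : MSeries s R)) ∧
      ((1 : MSeries.unitSeries s R) : MSeries s R) = MSeries.boxOne s R ∧
      (s = 1 → ∀ f g : MSeries.unitSeries s R, f * g = g * f) ∧
      (2 ≤ s → Nontrivial R → ∃ f g : MSeries.unitSeries s R, f * g ≠ g * f) := by
  open MSeries in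
  refine ⟨add_group_laws, ⟨box_assoc, boxOne_box, box_boxOne⟩,
    fun _ => ⟨exists_add_box_ne ⟨0, hs⟩, exists_box_add_ne ⟨0, hs⟩⟩, ?_, ?_,
    unitSeriesGroup s R, fun _ _ => rfl, rfl, ?_, ?_⟩
  · rintro rfl f g
    exact box_comm f g
  · intro h _
    obtain ⟨f, -, g, -, hfg⟩ := exists_unitSeries_box_ne (R := R) h
    exact ⟨f, g, hfg⟩
  · rintro rfl f g
    exact Subtype.ext (box_comm f.1 g.1)
  · intro h _
    obtain ⟨f, hf, g, hg, hfg⟩ := exists_unitSeries_box_ne (R := R) h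
    exact ⟨⟨f, hf⟩, ⟨g, hg⟩, fun h => hfg (congrArg Subtype.val h)⟩
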